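/- Let $f:[0,1]\to(0,1)$ be a $C^3$ function all of whose fixed points are isolated, and suppose $f\ge 1/2$ on $[0,1]$. For $a\in[0,1]$ and $l>0$, an urn process associated to $f$ started from $(a,l)$ is a random sequence $(\alpha_n)_{n\ge0}$ with $\alpha_0=a$ such that, conditionally on $\alpha_0,\dots,\alpha_n$, a red ball is drawn with probability $f(\alpha_n)$, in which case $\alpha_{n+1}=\frac{(l+n)\alpha_n+1}{l+n+1}$, and a blue ball is drawn with probability $1-f(\alpha_n)$, in which case $\alpha_{n+1}=\frac{(l+n)\alpha_n}{l+n+1}$. Let $w_0=(\alpha_0^x,l_0^x)_{x\in\mathbb Z}\in([0,1]\times(0,\infty))^{\mathbb Z}$ be an initial environment with $w_0^x=w_0^1$ for all $x\ge1$, and let $(\alpha^x_n)_{n\ge0}$, $x\in\mathbb Z$, be independent urn processes associated to $f$, the one at $x$ being started from $w_0^x$. Let $(X_n)_{n\ge0}$ be the generalized reinforced random walk on $\mathbb Z$ driven by these urns: $X_0=0$, and if $X_n=x$ and the walk has visited $x$ exactly $k$ times strictly before time $n$, then $X_{n+1}=x+1$ if the ball drawn from the urn at $x$ in its step from $\alpha^x_k$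 to $\alpha^x_{k+1}$ is red, and $X_{n+1}=x-1$ otherwise. Put $\delta^1_\infty=\sum_{k=0}^\infty\bigl(2f(\alpha^1_k)-1\bigr)\in[0,\infty]$. Call the walk recurrent if almost surely it visits every site of $\mathbb Z$ infinitely often, and transient if almost surely it converges to $+\infty$ or to $-\infty$. Then $(X_n)_{n\ge0}$ is either recurrent or transient, and it is recurrent if and only if $\mathbb E[\delta^1_\infty]\le1$. -/

import Mathlib

open Set Filter Topology MeasureTheory ProbabilityTheory

/-- Proportion of red balls after a red draw, from an urn with proportion `a` of red balls and
`l` balls in total. -/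
noncomputable def redUpdate (a l : ℝ) : ℝ := (l * a + 1) / (l + 1)

/-- Proportion of red balls after a blue draw, from an urn with proportion `a` of red balls and
`l` balls in total. -/
noncomputable def blueUpdate (a l : ℝ) : ℝ := l * a / (l + 1)

/-- The σ-algebra generated by `α 0, …, α n`. -/
abbrev history {Ω : Type*} (α : ℕ → Ω → ℝ) (n : ℕ) : MeasurableSpace Ω :=
  ⨆ j ∈ Set.Iic n, MeasurableSpace.comap (α j) inferInstance

/-- `α` is (the first coordinate of) an urn process associated to `f`, started with a proportion
`a` of red balls and total weight `l`. The total weight at time `n` is `l + n`; conditionally on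
`α 0, …, α n` the next ball is red with probability `f (α n)` and blue with probability
`1 - f (α n)`. -/
structure IsUrnProcess {Ω : Type*} [MeasurableSpace Ω] (μ : Measure Ω) (f : ℝ → ℝ) (a l : ℝ)
    (α : ℕ → Ω → ℝ) : Prop where
  measurable : ∀ n, Measurable (α n)
  init : ∀ᵐ ω ∂μ, α 0 ω = a
  red : ∀ n : ℕ, μ⟦{ω | α (n + 1) ω = redUpdate (α n ω) (l + n)} | history α n⟧
    =ᵐ[μ] fun ω => f (α n ω)
  blue : ∀ n : ℕ, μ⟦{ω | α (n + 1) ω = blueUpdate (α n ω) (l + n)} | history α n⟧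
    =ᵐ[μ] fun ω => 1 - f (α n ω)

/-- The number of visits of the path `X` to the site `x` strictly before time `n`. -/
def visits (X : ℕ → ℤ) (x : ℤ) (n : ℕ) : ℕ := ((Finset.range n).filter (fun k => X k = x)).card

open Classical in
/-- `X` is the generalized reinforced random walk associated to `f`, started at the site `x₀` with
initial environment `(a₀ x, l₀ x)` at each site `x`, and driven by the independent urn processes
`α x`, one at each site: the `k`-th departure (counted from `0`) from a site is to the
right if the `k`-th ball drawn from the urn at this site is red, and to the left otherwise. -/
structure IsReinforcedWalk {Ω : Type*} [MeasurableSpace Ω] (μ : Measure Ω) (f : ℝ → ℝ)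
    (a₀ l₀ : ℤ → ℝ) (x₀ : ℤ) (α : ℤ → ℕ → Ω → ℝ) (X : ℕ → Ω → ℤ) : Prop where
  urn : ∀ x, IsUrnProcess μ f (a₀ x) (l₀ x) (α x)
  indep : iIndepFun (fun (x : ℤ) (ω : Ω) (n : ℕ) => α x n ω) μ
  start : ∀ ω, X 0 ω = x₀
  step : ∀ (n : ℕ) (ω : Ω) (x : ℤ) (k : ℕ), X n ω = x → visits (fun m => X m ω) x n = k →
    X (n + 1) ω =
      if α x (k + 1) ω = redUpdate (α x k ω) (l₀ x + k) then x + 1 else x - 1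

/-- The path visits every site infinitely often. -/
def IsRecurrentPath (X : ℕ → ℤ) : Prop := ∀ x : ℤ, ∃ᶠ n in atTop, X n = x

/-- The path converges to `+∞` or to `-∞`. -/
def IsTransientPath (X : ℕ → ℤ) : Prop := Tendsto X atTop atTop ∨ Tendsto X atTop atBot

/-- The total drift `∑ₖ (2 f(αₖ) - 1)` of an urn, for `f ≥ 1/2`, as an element of `[0, ∞]`. -/
noncomputable def totalDrift (f : ℝ → ℝ) (α : ℕ → ℝ) : ENNReal :=
  ∑' k : ℕ, ENNReal.ofReal (2 * f (α k) - 1)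

/-!
Count the left jumps made by the walk from the sites `1, 2, …` before it first reaches `j`. Seen
from `j` backwards, these counts follow the recursion `Z ↦ B(s, Z)`, where `B(s, y)` is the number
of blue draws before the `(y + 1)`-th red one in the urn `s`, and the number of left jumps from `1`
increases to a limit `L` as `j → ∞`. The walk goes to `+∞` exactly when `L < ∞`, and `L` is a
functional of independent urns for which `L = ∞` is a zero-one event.

Let `d(y)` be the expected drift of an urn up to its `(y + 1)`-th red draw. Optional stopping gives
`E B(y) + d(y) = y + 1`. If `L = ∞` almost surely, the counts increase to infinity while their mean
increases by `1 - E d(Z)` at each step, so the total expected drift is at most `1`. Conversely,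
the exponential martingale `(1 + t) ^ reds * (1 - t) ^ blues` of fair draws, as `t → 0`, shows
`P(L < ∞) ≤ E[d(L); L < ∞]`; as `d(y) < 1` for finite `y` once the total is at most `1`, this rules
out `L < ∞` almost surely. The same inequality applied to the reflected walk, whose drift is
nonpositive, excludes convergence to `-∞`.
-/

/-! ### Draw sequences -/

lemma exists_count_eq_of_frequently {p : ℕ → Prop} [DecidablePred p] (h : ∃ᶠ k in atTop, p k)
    (y : ℕ) : ∃ n, Nat.count p n = y ∧ p n :=
  have hp : (Set.ofPred p).Infinite := Nat.frequently_atTop_iff_infinite.1 h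
  ⟨Nat.nth p y, Nat.count_nth_of_infinite hp y, Nat.nth_mem_of_infinite hp y⟩

/-- The number of red draws among the first `n` draws of the sequence `s`; here and below `true`
encodes red, i.e. a jump to the right. -/
def reds (s : ℕ → Bool) (n : ℕ) : ℕ := Nat.count (fun k => s k = true) n

/-- The number of blue draws among the first `n` draws of the sequence `s`. -/
def blues (s : ℕ → Bool) (n : ℕ) : ℕ := Nat.count (fun k => s k = false) n

section Draws

variable {s : ℕ → Bool} {n : ℕ} {y : ℕ∞}

@[simp] lemma reds_zero (s : ℕ → Bool) : reds s 0 = 0 := rfl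

@[simp] lemma blues_zero (s : ℕ → Bool) : blues s 0 = 0 := rfl

lemma reds_succ (s : ℕ → Bool) (n : ℕ) :
    reds s (n + 1) = reds s n + if s n = true then 1 else 0 :=
  Nat.count_succ _ _

lemma blues_succ (s : ℕ → Bool) (n : ℕ) :
    blues s (n + 1) = blues s n + if s n = false then 1 else 0 :=
  Nat.count_succ _ _

lemma reds_mono (s : ℕ → Bool) : Monotone (reds s) := Nat.count_monotone _

lemma blues_mono (s : ℕ → Bool) : Monotone (blues s) := Nat.count_monotone _

lemma reds_add_blues (s : ℕ → Bool) (n : ℕ) : reds s n + blues s n = n := by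
  induction n with
  | zero => rfl
  | succ n ih => rw [reds_succ, blues_succ]; cases s n <;> simp <;> omega

lemma le_of_reds_le_reds {m : ℕ} (hs : s n = true) (h : reds s m ≤ reds s n) : m ≤ n :=
  not_lt.1 fun hlt => h.not_gt (Nat.count_strict_mono (p := fun k => s k = true) hs hlt)

lemma dependsOn_reds (n : ℕ) : DependsOn (reds · n) (Iio n) := by
  intro s t h
  simp only [reds, Nat.count_eq_card_filter_range]
  congr 1
  exact Finset.filter_congr fun k hk => by rw [h k (Finset.mem_range.1 hk)]

/-- Both colours occur infinitely often in the sequence of draws `s`. -/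
def IsMixed (s : ℕ → Bool) : Prop := ∀ c : Bool, ∃ᶠ k in atTop, s k = c

lemma IsMixed.exists_reds_eq (h : IsMixed s) (y : ℕ) : ∃ n, reds s n = y ∧ s n = true :=
  exists_count_eq_of_frequently (h true) y

lemma IsMixed.exists_blues_eq (h : IsMixed s) (y : ℕ) : ∃ n, blues s n = y ∧ s n = false :=
  exists_count_eq_of_frequently (h false) y

/-- The number of blue draws before the `(y + 1)`-th red draw, as a supremum of the values
`blues s n` over the times `n` at which at most `y` red balls have been drawn. -/
noncomputable def bluesBefore (s : ℕ → Bool) (y : ℕ∞) : ℕ∞ :=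
  ⨆ n : ℕ, if (reds s n : ℕ∞) ≤ y then (blues s n : ℕ∞) else 0

lemma blues_le_bluesBefore (h : (reds s n : ℕ∞) ≤ y) : (blues s n : ℕ∞) ≤ bluesBefore s y :=
  le_iSup_of_le n (if_pos h).ge

lemma bluesBefore_le {b : ℕ∞} (h : ∀ n, (reds s n : ℕ∞) ≤ y → (blues s n : ℕ∞) ≤ b) :
    bluesBefore s y ≤ b :=
  iSup_le fun n => by
    split_ifs with hn
    exacts [h n hn, zero_le]

lemma bluesBefore_mono (s : ℕ → Bool) : Monotone (bluesBefore s) :=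
  fun _ _ hyz => bluesBefore_le fun _ hn => blues_le_bluesBefore (hn.trans hyz)

lemma bluesBefore_reds (h : s n = true) : bluesBefore s (reds s n) = blues s n :=
  le_antisymm
    (bluesBefore_le fun _ hm =>
      Nat.cast_le.2 (blues_mono s (le_of_reds_le_reds h (Nat.cast_le.1 hm))))
    (blues_le_bluesBefore le_rfl)

lemma IsMixed.bluesBefore_eq_top_iff (h : IsMixed s) : bluesBefore s y = ⊤ ↔ y = ⊤ := by
  refine ⟨fun hy => ?_, ?_⟩
  · by_contra hne
    lift y to ℕ using hne
    obtain ⟨n, rfl, hn⟩ := h.exists_reds_eq y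
    exact ENat.natCast_ne_top _ ((bluesBefore_reds hn).symm.trans hy)
  · rintro rfl
    refine ENat.eq_top_iff_forall_ge.2 fun m => ?_
    obtain ⟨n, rfl, -⟩ := h.exists_blues_eq m
    exact blues_le_bluesBefore le_top

lemma natCast_le_iSup_iff {u : ℕ → ℕ∞} :
    ∀ {m : ℕ}, (m : ℕ∞) ≤ ⨆ j, u j ↔ ∃ j, (m : ℕ∞) ≤ u j
  | 0 => by simp
  | m + 1 => by
    simp only [Nat.cast_succ, ENat.add_one_le_iff (ENat.natCast_ne_top m), lt_iSup_iff]

lemma bluesBefore_iSup (s : ℕ → Bool) (u : ℕ → ℕ∞) :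
    bluesBefore s (⨆ j, u j) = ⨆ j, bluesBefore s (u j) := by
  refine le_antisymm (bluesBefore_le fun n hn => ?_)
    (iSup_le fun j => bluesBefore_mono s (le_iSup u j))
  obtain ⟨j, hj⟩ := natCast_le_iSup_iff.1 hn
  exact le_iSup_of_le j (blues_le_bluesBefore hj)

end Draws

/-! ### The backward recursion -/

/-- The backward recursion `Z₀ = 0`, `Zⱼ₊₁(S) = bluesBefore (S 0) (Zⱼ(S 1, S 2, …))`. When `S i` is
the sequence of draws at the site `x + i`, the value `backward j S` is the number of left jumps
from `x` before the first passage at `x + j`. -/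
noncomputable def backward : ℕ → (ℕ → ℕ → Bool) → ℕ∞
  | 0, _ => 0
  | j + 1, S => bluesBefore (S 0) (backward j fun i => S (i + 1))

lemma backward_mono (S : ℕ → ℕ → Bool) : Monotone (backward · S) := by
  refine monotone_nat_of_le_succ fun j => ?_
  induction j generalizing S with
  | zero => exact zero_le
  | succ j ih => exact bluesBefore_mono _ (ih _)

/-- The limit of the backward recursion: the number of left jumps from `x` when the walk escapes to
`+∞`, and `⊤` when it does not. -/
noncomputable def backwardLim (S : ℕ → ℕ → Bool) : ℕ∞ := ⨆ j, backward j S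

lemma backwardLim_eq_bluesBefore (S : ℕ → ℕ → Bool) :
    backwardLim S = bluesBefore (S 0) (backwardLim fun i => S (i + 1)) := by
  rw [backwardLim, backwardLim, bluesBefore_iSup]
  exact ((backward_mono S).iSup_nat_add 1).symm

/-! ### Nearest-neighbour paths driven by draws -/

section Visits

variable {X : ℕ → ℤ} {x : ℤ}

lemma visits_eq_count (X : ℕ → ℤ) (x : ℤ) (n : ℕ) :
    visits X x n = Nat.count (fun k => X k = x) n :=
  (Nat.count_eq_card_filter_range _ _).symm

lemma visits_succ (X : ℕ → ℤ) (x : ℤ) (n : ℕ) :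
    visits X x (n + 1) = visits X x n + if X n = x then 1 else 0 := by
  simp only [visits_eq_count, Nat.count_succ]

lemma visits_mono (X : ℕ → ℤ) (x : ℤ) : Monotone (visits X x) := by
  simpa only [visits_eq_count, funext (visits_eq_count X x)] using Nat.count_monotone _

lemma visits_eq_zero {n : ℕ} (h : ∀ m < n, X m ≠ x) : visits X x n = 0 :=
  Finset.card_eq_zero.2 (Finset.filter_eq_empty_iff.2 fun m hm => h m (Finset.mem_range.1 hm))

lemma visits_le_visits {K : ℕ} (h : ∀ m, K ≤ m → X m ≠ x) (n : ℕ) :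
    visits X x n ≤ visits X x K :=
  Finset.card_le_card fun m hm => by
    obtain ⟨-, hm⟩ := Finset.mem_filter.1 hm
    exact Finset.mem_filter.2 ⟨Finset.mem_range.2 (not_le.1 fun hK => h m hK hm), hm⟩

lemma exists_visits_eq (h : ∃ᶠ n in atTop, X n = x) (k : ℕ) : ∃ n, visits X x n = k ∧ X n = x := by
  simpa only [visits_eq_count] using exists_count_eq_of_frequently h k

lemma visits_neg (X : ℕ → ℤ) (x : ℤ) (n : ℕ) : visits (fun m => -X m) x n = visits X (-x) n := by
  simp only [visits, neg_eq_iff_eq_neg]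

lemma tendsto_atTop_of_eventually_pos (hpos : ∀ᶠ n in atTop, 0 < X n)
    (hne : ∀ x, ∀ᶠ n in atTop, X n ≠ x) : Tendsto X atTop atTop := by
  refine tendsto_atTop.2 fun b => ?_
  have hfin : ∀ᶠ n in atTop, ∀ x ∈ Icc 0 b, X n ≠ x :=
    (Filter.eventually_all_finite (finite_Icc 0 b)).2 fun x _ => hne x
  filter_upwards [hpos, hfin] with n hn hn'
  by_contra hlt
  exact hn' (X n) ⟨hn.le, (not_le.1 hlt).le⟩ rfl

end Visits

/-- `X` is the path on `ℤ` started at `0` whose `k`-th departure (counted from `0`) from each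
site `x` is to the right if `s x k = true`, and to the left otherwise. -/
structure IsDriven (s : ℤ → ℕ → Bool) (X : ℕ → ℤ) : Prop where
  start : X 0 = 0
  step : ∀ n, X (n + 1) = if s (X n) (visits X (X n) n) = true then X n + 1 else X n - 1

namespace IsDriven

variable {s : ℤ → ℕ → Bool} {X : ℕ → ℤ} {x : ℤ}

lemma neg (h : IsDriven s X) : IsDriven (fun x k => !s (-x) k) (fun n => -X n) where
  start := by simp [h.start]
  step n := by
    rw [visits_neg, neg_neg, h.step]
    cases s (X n) (visits X (X n) n) <;> simp <;> ring

lemma step_cases (h : IsDriven s X) (n : ℕ) :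
    (s (X n) (visits X (X n) n) = true ∧ X (n + 1) = X n + 1) ∨
    (s (X n) (visits X (X n) n) = false ∧ X (n + 1) = X n - 1) := by
  rw [h.step n]
  cases s (X n) (visits X (X n) n) <;> simp

lemma le_time (h : IsDriven s X) (n : ℕ) : X n ≤ n := by
  induction n with
  | zero => simp [h.start]
  | succ n ih =>
    push_cast
    rcases h.step_cases n with ⟨-, hX⟩ | ⟨-, hX⟩ <;> omega

lemma exists_first_passage (h : IsDriven s X) {N : ℕ} (hN : ∃ n, (N : ℤ) ≤ X n) :
    ∃ n, X n = N ∧ ∀ m < n, X m < X n := by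
  classical
  obtain ⟨n, hn, hmin⟩ : ∃ n, (N : ℤ) ≤ X n ∧ ∀ m < n, ¬ (N : ℤ) ≤ X m :=
    ⟨Nat.find hN, Nat.find_spec hN, fun m => Nat.find_min hN⟩
  have hXn : X n = N := by
    rcases n with _ | n
    · rw [h.start] at hn ⊢; omega
    · have := hmin n n.lt_succ_self
      rcases h.step_cases n with ⟨-, hX⟩ | ⟨-, hX⟩ <;> omega
  exact ⟨n, hXn, fun m hm => by have := hmin m hm; omega⟩

lemma reds_visits (h : IsDriven s X) (hx : 0 ≤ x) (n : ℕ) :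
    reds (s x) (visits X x n) =
      blues (s (x + 1)) (visits X (x + 1) n) + if x < X n then 1 else 0 := by
  induction n with
  | zero => simp [visits, h.start, hx.not_gt]
  | succ n ih =>
    rw [visits_succ, visits_succ]
    by_cases hXx : X n = x
    · subst hXx
      rw [if_pos rfl, if_neg (by omega), reds_succ, ih]
      rcases h.step_cases n with ⟨hs, hX⟩ | ⟨hs, hX⟩ <;> rw [hs, hX] <;> simp
    rw [if_neg hXx, add_zero, ih]
    by_cases hXx' : X n = x + 1
    · rw [if_pos hXx', blues_succ, ← hXx']
      rcases h.step_cases n with ⟨hs, hX⟩ | ⟨hs, hX⟩ <;> rw [hs, hX] <;> simp <;>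
        split_ifs <;> omega
    · rw [if_neg hXx', add_zero]
      rcases h.step_cases n with ⟨-, hX⟩ | ⟨-, hX⟩ <;> rw [hX] <;> split_ifs <;> omega

lemma exists_last_departure (h : IsDriven s X) (hx : 0 ≤ x) {n : ℕ} (hn : x < X n) :
    ∃ k, visits X x n = k + 1 ∧ s x k = true := by
  induction n with
  | zero => rw [h.start] at hn; omega
  | succ n ih =>
    rw [visits_succ]
    rcases lt_trichotomy (X n) x with hXx | hXx | hXx
    · rcases h.step_cases n with ⟨-, hX⟩ | ⟨-, hX⟩ <;> omega
    · refine ⟨visits X x n, by rw [if_pos hXx], ?_⟩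
      rcases h.step_cases n with ⟨hs, -⟩ | ⟨-, hX⟩
      · rwa [hXx] at hs
      · omega
    · obtain ⟨k, hk, hs⟩ := ih hXx
      exact ⟨k, by rw [if_neg hXx.ne', hk], hs⟩

lemma blues_visits_eq_backward (h : IsDriven s X) {n : ℕ} (hn : ∀ m < n, X m ≠ X n) (j : ℕ)
    (hx : 0 ≤ x) (hj : x + j = X n) :
    (blues (s x) (visits X x n) : ℕ∞) = backward j (fun i => s (x + i)) := by
  induction j generalizing x with
  | zero =>
    obtain rfl : x = X n := by simpa using hj
    rw [visits_eq_zero hn]; rfl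
  | succ j ih =>
    push_cast at hj
    have hlt : x < X n := by omega
    obtain ⟨k, hk, hs⟩ := h.exists_last_departure hx hlt
    have hreds : reds (s x) k = blues (s (x + 1)) (visits X (x + 1) n) := by
      have := h.reds_visits hx n
      rw [hk, if_pos hlt, reds_succ, if_pos hs] at this
      omega
    have hshift : (fun i : ℕ => s (x + ((i + 1 : ℕ) : ℤ))) = fun i : ℕ => s (x + 1 + (i : ℤ)) := by
      funext i; congr 1; push_cast; ring
    calc (blues (s x) (visits X x n) : ℕ∞) = blues (s x) k := by simp [hk, blues_succ, hs]
      _ = bluesBefore (s x) (reds (s x) k) := (bluesBefore_reds hs).symm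
      _ = backward (j + 1) fun i => s (x + i) := by
          rw [hreds, ih (by omega) (by omega), backward, hshift, Nat.cast_zero, add_zero]

lemma backwardLim_lt_top (h : IsDriven s X) (hX : Tendsto X atTop atTop) :
    backwardLim (fun i => s (1 + i)) < ⊤ := by
  obtain ⟨K, hK⟩ := eventually_atTop.1 (hX.eventually_gt_atTop 1)
  refine lt_of_le_of_lt (iSup_le fun j => ?_) (ENat.natCast_lt_top (visits X 1 K))
  obtain ⟨n, hn, hlt⟩ := h.exists_first_passage (N := 1 + j) (hX.eventually_ge_atTop _).exists
  rw [← h.blues_visits_eq_backward (fun m hm => (hlt m hm).ne) j zero_le_one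
    (by rw [hn, Nat.cast_add, Nat.cast_one])]
  have hblues : blues (s 1) (visits X 1 n) ≤ visits X 1 n := Nat.count_le _
  exact_mod_cast hblues.trans (visits_le_visits (fun m hm => (hK m hm).ne') n)

lemma backwardLim_eq_top (h : IsDriven s X) (hs : IsMixed (s 1)) (hX : IsRecurrentPath X) :
    backwardLim (fun i => s (1 + i)) = ⊤ := by
  refine ENat.eq_top_iff_forall_ge.2 fun K => ?_
  obtain ⟨k, hk, -⟩ := hs.exists_blues_eq K
  obtain ⟨m, hm, -⟩ := exists_visits_eq (hX 1) k
  obtain ⟨n', hn'⟩ := (hX ((1 + m : ℕ) : ℤ)).exists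
  obtain ⟨n, hn, hlt⟩ := h.exists_first_passage ⟨n', hn'.ge⟩
  have hmn : m ≤ n := by have := h.le_time n; omega
  refine le_trans ?_ (le_iSup _ m)
  rw [← h.blues_visits_eq_backward (fun m hm => (hlt m hm).ne) m zero_le_one
    (by rw [hn, Nat.cast_add, Nat.cast_one]), ← hk, ← hm]
  exact_mod_cast blues_mono _ (visits_mono X 1 hmn)

lemma frequently_neighbour (h : IsDriven s X) (hs : IsMixed (s x))
    (hx : ∃ᶠ n in atTop, X n = x) (c : Bool) :
    ∃ᶠ n in atTop, X n = if c = true then x + 1 else x - 1 := by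
  refine frequently_atTop.2 fun M => ?_
  obtain ⟨k, hk, hc⟩ := frequently_atTop.1 (hs c) (visits X x M)
  obtain ⟨n, hv, hn⟩ := exists_visits_eq hx k
  refine ⟨n + 1, ?_, by rw [h.step, hn, hv, hc]⟩
  by_contra hlt
  have := visits_mono X x (not_le.1 hlt).le
  rw [visits_succ, if_pos hn] at this
  omega

lemma isRecurrentPath (h : IsDriven s X) (hs : ∀ x, IsMixed (s x))
    (hx : ∃ᶠ n in atTop, X n = x) : IsRecurrentPath X := fun y => by
  induction y using Int.inductionOn' (b := x) with
  | zero => exact hx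
  | succ k _ ih => exact h.frequently_neighbour (hs k) ih true
  | pred k _ ih => exact h.frequently_neighbour (hs k) ih false

lemma tendsto_atTop_of_pos (h : IsDriven s X) (hne : ∀ x, ∀ᶠ n in atTop, X n ≠ x) {N : ℕ}
    (hN : ∀ n, N ≤ n → X n ≠ 0) (hpos : 0 < X N) : Tendsto X atTop atTop := by
  refine tendsto_atTop_of_eventually_pos (eventually_atTop.2 ⟨N, fun n hn => ?_⟩) hne
  induction n, hn using Nat.le_induction with
  | base => exact hpos
  | succ n hn ih =>
    have := hN (n + 1) (by omega)
    rcases h.step_cases n with ⟨-, hX⟩ | ⟨-, hX⟩ <;> omega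

lemma isRecurrentPath_or_isTransientPath (h : IsDriven s X) (hs : ∀ x, IsMixed (s x)) :
    IsRecurrentPath X ∨ IsTransientPath X := by
  by_cases hx : ∃ x, ∃ᶠ n in atTop, X n = x
  · exact Or.inl (h.isRecurrentPath hs hx.choose_spec)
  have hne : ∀ x, ∀ᶠ n in atTop, X n ≠ x := fun x => not_frequently.1 fun hf => hx ⟨x, hf⟩
  obtain ⟨N, hN⟩ := eventually_atTop.1 (hne 0)
  refine Or.inr ((hN N le_rfl).gt_or_lt.imp (h.tendsto_atTop_of_pos hne hN) fun hneg => ?_)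
  refine tendsto_neg_atTop_iff.1 (h.neg.tendsto_atTop_of_pos (N := N) (fun x => ?_) ?_ ?_)
  · simpa only [ne_eq, neg_eq_iff_eq_neg] using hne (-x)
  · simpa only [ne_eq, neg_eq_zero] using hN
  · exact neg_pos.2 hneg

end IsDriven

/-! ### Laws of draw sequences -/

section Measurability

lemma measurable_of_dependsOn_Iio {β : Type*} [MeasurableSpace β] {n : ℕ} {g : (ℕ → Bool) → β}
    (hg : DependsOn g (Iio n)) : Measurable g := by
  have : Nonempty β := ⟨g fun _ => false⟩
  obtain ⟨g', rfl⟩ := dependsOn_iff_exists_comp.1 hg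
  exact (measurable_of_countable g').comp
    (measurable_pi_lambda _ fun i => measurable_pi_apply i.1)

lemma dependsOn_blues (n : ℕ) : DependsOn (blues · n) (Iio n) := fun s t h => by
  have hred : reds s n = reds t n := dependsOn_reds n h
  have hs := reds_add_blues s n
  have ht := reds_add_blues t n
  change blues s n = blues t n
  omega

lemma measurableSet_reds_le (n : ℕ) (y : ℕ∞) : MeasurableSet {s | (reds s n : ℕ∞) ≤ y} :=
  measurable_of_dependsOn_Iio (dependsOn_reds n) (.of_discrete (s := {r : ℕ | (r : ℕ∞) ≤ y}))

lemma measurableSet_cylinder (b : ℕ → Bool) (n : ℕ) : MeasurableSet (PiNat.cylinder b n) :=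
  (PiNat.isOpen_cylinder _ b n).measurableSet

lemma measurableSet_draw_eq (n : ℕ) (c : Bool) : MeasurableSet {s : ℕ → Bool | s n = c} :=
  measurableSet_eq_fun (measurable_pi_apply n) measurable_const

lemma measurable_not_comp : Measurable fun (s : ℕ → Bool) (k : ℕ) => !s k :=
  measurable_pi_lambda _ fun k => (measurable_of_countable Bool.not).comp (measurable_pi_apply k)

lemma measurable_bluesBefore : Measurable fun p : (ℕ → Bool) × ℕ∞ => bluesBefore p.1 p.2 := by
  have : BorelSpace ℕ∞ := ⟨borel_eq_top_of_countable.symm⟩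
  refine measurable_from_prod_countable_left fun y => Measurable.iSup fun n => ?_
  exact Measurable.ite (measurableSet_reds_le n y)
    ((measurable_of_countable _).comp (measurable_of_dependsOn_Iio (dependsOn_blues n)))
    measurable_const

lemma measurable_backward (j : ℕ) : Measurable (backward j) := by
  induction j with
  | zero => exact measurable_const
  | succ j ih =>
    have hshift : Measurable fun (S : ℕ → ℕ → Bool) (i : ℕ) => S (i + 1) :=
      measurable_pi_lambda _ fun i => measurable_pi_apply (i + 1)
    have hpair : Measurable fun S : ℕ → ℕ → Bool => (S 0, backward j fun i => S (i + 1)) :=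
      (measurable_pi_apply 0).prodMk (ih.comp hshift)
    exact measurable_bluesBefore.comp hpair

lemma measurable_backwardLim : Measurable backwardLim := by
  have : BorelSpace ℕ∞ := ⟨borel_eq_top_of_countable.symm⟩
  exact Measurable.iSup measurable_backward

end Measurability

section Cylinder

open PiNat

lemma cylinder_succ_eq_inter (b : ℕ → Bool) (n : ℕ) :
    cylinder b (n + 1) = cylinder b n ∩ {s | s n = b n} := by
  ext s
  simp only [mem_cylinder_iff, mem_inter_iff, mem_ofPred_eq, Nat.forall_lt_succ_right]

lemma cylinder_diff_red (b : ℕ → Bool) (n : ℕ) :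
    cylinder b n \ {s | s n = true} = cylinder b n ∩ {s | s n = false} := by
  ext s; simp

lemma isPiSystem_cylinder : IsPiSystem {A : Set (ℕ → Bool) | ∃ b n, A = PiNat.cylinder b n} := by
  rintro _ ⟨b, n, rfl⟩ _ ⟨b', m, rfl⟩ ⟨t, ht, ht'⟩
  rw [mem_cylinder_iff_eq] at ht ht'
  rcases le_total n m with h | h
  · exact ⟨t, m, by rw [← ht, ← ht', inter_eq_right.2 (cylinder_anti t h)]⟩
  · exact ⟨t, n, by rw [← ht, ← ht', inter_eq_left.2 (cylinder_anti t h)]⟩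

lemma lintegral_eq_of_cylinder {ν : Measure (ℕ → Bool)} {F G : (ℕ → Bool) → ENNReal} (n : ℕ)
    (h : ∀ b, ∫⁻ s in cylinder b n, F s ∂ν = ∫⁻ s in cylinder b n, G s ∂ν) :
    ∫⁻ s, F s ∂ν = ∫⁻ s, G s ∂ν := by
  let 𝒞 : Set (Set (ℕ → Bool)) := range (PiNat.cylinder · n)
  have hdisj : 𝒞.PairwiseDisjoint id := by
    rintro _ ⟨b, rfl⟩ _ ⟨b', rfl⟩ hne
    refine Set.disjoint_left.2 fun s hs hs' => hne ?_
    exact (mem_cylinder_iff_eq.1 hs).symm.trans (mem_cylinder_iff_eq.1 hs')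
  have hcount : 𝒞.Countable := by
    refine hdisj.countable_of_isOpen ?_ ?_
    · rintro _ ⟨b, rfl⟩; exact isOpen_cylinder _ b n
    · rintro _ ⟨b, rfl⟩; exact ⟨b, self_mem_cylinder b n⟩
  have hcover : ⋃ C ∈ 𝒞, id C = univ :=
    eq_univ_of_forall fun s => mem_biUnion (mem_range_self s) (self_mem_cylinder s n)
  have hmeas : ∀ C ∈ 𝒞, MeasurableSet (id C) := by
    rintro _ ⟨b, rfl⟩; exact measurableSet_cylinder b n
  rw [← setLIntegral_univ F, ← setLIntegral_univ G, ← hcover,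
    lintegral_biUnion hcount hmeas hdisj, lintegral_biUnion hcount hmeas hdisj]
  refine tsum_congr ?_
  rintro ⟨_, b, rfl⟩
  exact h b

end Cylinder

lemma countable_setOf_eventually_eq (c : Bool) :
    {s : ℕ → Bool | ∀ᶠ k in atTop, s k = c}.Countable := by
  have hinj : Function.Injective fun (s : ℕ → Bool) => {k | ¬ s k = c} := fun s t hst => by
    funext k
    have hk : s k ≠ c ↔ t k ≠ c := Set.ext_iff.1 hst k
    cases hs : s k <;> cases ht : t k <;> cases c <;> simp [hs, ht] at hk ⊢
  refine (Countable.ofPred_finite.preimage hinj).mono fun s hs => ?_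
  rwa [mem_ofPred_eq, ← Nat.cofinite_eq_atTop, eventually_cofinite] at hs

lemma ae_isMixed_of_nullSingletonClass (ν : Measure (ℕ → Bool)) [NullSingletonClass ν] :
    ∀ᵐ s ∂ν, IsMixed s := by
  refine ae_all_iff.2 fun c => ?_
  filter_upwards [(countable_setOf_eventually_eq !c).ae_notMem ν] with s hs
  simpa [Filter.Frequently, ← Bool.eq_not] using hs

/-- Under `ν`, conditionally on the first `n` draws `b 0, …, b (n - 1)`, the next draw is red with
probability `q n b`. -/
structure IsDrawLaw (ν : Measure (ℕ → Bool)) (q : ℕ → (ℕ → Bool) → ℝ) : Prop where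
  dependsOn : ∀ n, DependsOn (q n) (Iio n)
  mem_Icc : ∀ n b, q n b ∈ Icc (0 : ℝ) 1
  draw : ∀ n b, ν (PiNat.cylinder b n ∩ {s | s n = true}) =
    ν (PiNat.cylinder b n) * ENNReal.ofReal (q n b)

/-- Uniform ellipticity: the conditional probabilities `q` of a red draw stay away from `0` and
from `1`. -/
def IsElliptic (q : ℕ → (ℕ → Bool) → ℝ) : Prop := ∃ c > 0, ∀ n b, q n b ∈ Icc c (1 - c)

lemma IsElliptic.flip {q : ℕ → (ℕ → Bool) → ℝ} (hq : IsElliptic q) :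
    IsElliptic fun n s => 1 - q n fun k => !s k := by
  obtain ⟨c, hc, hq⟩ := hq
  exact ⟨c, hc, fun n b => ⟨le_sub_comm.1 (hq n _).2, sub_le_sub_left (hq n _).1 1⟩⟩

namespace IsDrawLaw

open PiNat

variable {ν : Measure (ℕ → Bool)} {q : ℕ → (ℕ → Bool) → ℝ}

lemma measurable (h : IsDrawLaw ν q) (n : ℕ) : Measurable (q n) :=
  measurable_of_dependsOn_Iio (h.dependsOn n)

variable [IsProbabilityMeasure ν]

lemma draw_blue (h : IsDrawLaw ν q) (n : ℕ) (b : ℕ → Bool) :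
    ν (cylinder b n ∩ {s | s n = false}) = ν (cylinder b n) * ENNReal.ofReal (1 - q n b) := by
  have hadd := measure_inter_add_sdiff (μ := ν) (cylinder b n) (measurableSet_draw_eq n true)
  have hfin : ν (cylinder b n) * ENNReal.ofReal (q n b) ≠ ⊤ :=
    ENNReal.mul_ne_top (measure_ne_top _ _) ENNReal.ofReal_ne_top
  rw [cylinder_diff_red, h.draw] at hadd
  refine (ENNReal.add_right_inj hfin).1 ?_
  rw [hadd, ← mul_add, ← ENNReal.ofReal_add (h.mem_Icc n b).1 (sub_nonneg.2 (h.mem_Icc n b).2),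
    add_sub_cancel, ENNReal.ofReal_one, mul_one]

lemma measure_cylinder_succ (h : IsDrawLaw ν q) (b : ℕ → Bool) (n : ℕ) :
    ν (cylinder b (n + 1)) =
      ν (cylinder b n) * ENNReal.ofReal (if b n = true then q n b else 1 - q n b) := by
  rw [cylinder_succ_eq_inter]
  cases b n
  exacts [h.draw_blue n b, h.draw n b]

lemma flip (h : IsDrawLaw ν q) :
    IsDrawLaw (ν.map fun s k => !s k) (fun n s => 1 - q n fun k => !s k) where
  dependsOn n s t hst := congrArg (1 - ·) (h.dependsOn n fun k hk => by rw [hst k hk])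
  mem_Icc n b :=
    ⟨sub_nonneg.2 (h.mem_Icc n _).2, sub_le_self _ (h.mem_Icc n _).1⟩
  draw n b := by
    have hpre : (fun (s : ℕ → Bool) (k : ℕ) => !s k) ⁻¹' cylinder b n =
        cylinder (fun k => !b k) n := by
      ext s
      simp only [mem_preimage, mem_cylinder_iff, Bool.not_eq_eq_eq_not]
    rw [Measure.map_apply measurable_not_comp
        ((measurableSet_cylinder b n).inter (measurableSet_draw_eq n true)),
      Measure.map_apply measurable_not_comp (measurableSet_cylinder b n), preimage_inter, hpre,
      ← h.draw_blue]
    simp only [preimage_ofPred_eq, Bool.not_eq_true']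

lemma eq_of_isDrawLaw {ν' : Measure (ℕ → Bool)} [IsProbabilityMeasure ν']
    (h : IsDrawLaw ν q) (h' : IsDrawLaw ν' q) : ν = ν' := by
  refine ext_of_generate_finite _
    (BorelSpace.measurable_eq.trans
      (isTopologicalBasis_cylinders fun _ => Bool).borel_eq_generateFrom)
    isPiSystem_cylinder ?_ (by simp)
  rintro _ ⟨b, n, rfl⟩
  induction n with
  | zero => simp
  | succ n ih => rw [h.measure_cylinder_succ, h'.measure_cylinder_succ, ih]

lemma measure_cylinder_ne_zero (h : IsDrawLaw ν q) (hq : IsElliptic q) (b : ℕ → Bool) (n : ℕ) :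
    ν (cylinder b n) ≠ 0 := by
  obtain ⟨c, hc, hq⟩ := hq
  induction n with
  | zero => simp
  | succ n ih =>
    rw [h.measure_cylinder_succ]
    refine mul_ne_zero ih (ENNReal.ofReal_pos.2 ?_).ne'
    split_ifs
    · linarith [(hq n b).1]
    · linarith [(hq n b).2]

lemma measure_cylinder_le (h : IsDrawLaw ν q) {c : ℝ} (hq : ∀ n b, q n b ∈ Icc c (1 - c))
    (b : ℕ → Bool) (n : ℕ) : ν (cylinder b n) ≤ ENNReal.ofReal (1 - c) ^ n := by
  induction n with
  | zero => simp
  | succ n ih =>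
    rw [h.measure_cylinder_succ, pow_succ]
    gcongr
    split_ifs
    · exact (hq n b).2
    · linarith [(hq n b).1]

lemma nullSingletonClass (h : IsDrawLaw ν q) (hq : IsElliptic q) : NullSingletonClass ν := by
  obtain ⟨c, hc, hq⟩ := hq
  refine ⟨fun b => le_antisymm (ge_of_tendsto' (ENNReal.tendsto_pow_atTop_nhds_zero_of_lt_one
    (ENNReal.ofReal_lt_one.2 (sub_lt_self 1 hc))) fun n => ?_) zero_le⟩
  exact (measure_mono (singleton_subset_iff.2 (self_mem_cylinder b n))).trans
    (h.measure_cylinder_le hq b n)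

lemma ae_isMixed (h : IsDrawLaw ν q) (hq : IsElliptic q) : ∀ᵐ s ∂ν, IsMixed s :=
  have := h.nullSingletonClass hq
  ae_isMixed_of_nullSingletonClass ν

lemma lintegral_draw (h : IsDrawLaw ν q) {n : ℕ} {g : Bool → (ℕ → Bool) → ENNReal}
    (hg : ∀ c, DependsOn (g c) (Iio n)) :
    ∫⁻ s, g (s n) s ∂ν =
      ∫⁻ s, (ENNReal.ofReal (q n s) * g true s + ENNReal.ofReal (1 - q n s) * g false s) ∂ν := by
  refine lintegral_eq_of_cylinder n fun b => ?_
  have hcyl := measurableSet_cylinder b n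
  have hconst : ∀ c, ∫⁻ s in cylinder b n ∩ {s | s n = c}, g (s n) s ∂ν =
      g c b * ν (cylinder b n ∩ {s | s n = c}) := fun c => by
    rw [← setLIntegral_const]
    refine setLIntegral_congr_fun (hcyl.inter (measurableSet_draw_eq n c)) ?_
    rintro s ⟨hs, rfl⟩
    exact hg _ hs
  calc ∫⁻ s in cylinder b n, g (s n) s ∂ν
      = g true b * ν (cylinder b n ∩ {s | s n = true}) +
          g false b * ν (cylinder b n ∩ {s | s n = false}) := by
        rw [← lintegral_inter_add_sdiff _ _ (measurableSet_draw_eq n true), cylinder_diff_red,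
          hconst, hconst]
    _ = (ENNReal.ofReal (q n b) * g true b + ENNReal.ofReal (1 - q n b) * g false b) *
          ν (cylinder b n) := by
        rw [h.draw, h.draw_blue]; ring
    _ = ∫⁻ s in cylinder b n,
          (ENNReal.ofReal (q n s) * g true s + ENNReal.ofReal (1 - q n s) * g false s) ∂ν := by
        rw [← setLIntegral_const]
        refine setLIntegral_congr_fun hcyl fun s hs => ?_
        rw [h.dependsOn n hs, hg true hs, hg false hs]

end IsDrawLaw

/-! ### Sums up to a red draw -/

section SumUpTo

open scoped ENNReal

variable {s : ℕ → Bool} {n : ℕ}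

/-- The sum of `g` over all draws of `s` up to and including the `(y + 1)`-th red one. -/
noncomputable def sumUpTo (s : ℕ → Bool) (y : ℕ∞) (g : ℕ → ℝ≥0∞) : ℝ≥0∞ :=
  ∑' k, if (reds s k : ℕ∞) ≤ y then g k else 0

lemma sumUpTo_mono {y z : ℕ∞} (hyz : y ≤ z) {f g : ℕ → ℝ≥0∞}
    (hfg : ∀ k, (reds s k : ℕ∞) ≤ y → f k ≤ g k) : sumUpTo s y f ≤ sumUpTo s z g := by
  refine ENNReal.tsum_le_tsum fun k => ?_
  by_cases hk : (reds s k : ℕ∞) ≤ y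
  · rw [if_pos hk, if_pos (hk.trans hyz)]
    exact hfg k hk
  · rw [if_neg hk]
    exact zero_le

lemma sumUpTo_add (s : ℕ → Bool) (y : ℕ∞) (f g : ℕ → ℝ≥0∞) :
    sumUpTo s y (fun k => f k + g k) = sumUpTo s y f + sumUpTo s y g := by
  simp only [sumUpTo, ← ENNReal.tsum_add, ← ite_add_zero]

lemma sumUpTo_const_mul (s : ℕ → Bool) (y : ℕ∞) (c : ℝ≥0∞) (g : ℕ → ℝ≥0∞) :
    sumUpTo s y (fun k => c * g k) = c * sumUpTo s y g := by
  simp only [sumUpTo, ← ENNReal.tsum_mul_left, mul_ite, mul_zero]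

lemma sumUpTo_top (s : ℕ → Bool) (g : ℕ → ℝ≥0∞) : sumUpTo s ⊤ g = ∑' k, g k := by
  simp only [sumUpTo, le_top, if_true]

lemma sumUpTo_reds (h : s n = true) (g : ℕ → ℝ≥0∞) :
    sumUpTo s (reds s n) g = ∑ k ∈ Finset.range (n + 1), g k := by
  have hle : ∀ k, (reds s k : ℕ∞) ≤ reds s n ↔ k ∈ Finset.range (n + 1) := fun k => by
    rw [Nat.cast_le, Finset.mem_range_succ_iff]
    exact ⟨le_of_reds_le_reds h, fun hk => reds_mono s hk⟩
  rw [sumUpTo, tsum_eq_sum (s := Finset.range (n + 1)) fun k hk => if_neg (mt (hle k).1 hk)]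
  exact Finset.sum_congr rfl fun k hk => if_pos ((hle k).2 hk)

lemma sum_draws_red (s : ℕ → Bool) (n : ℕ) :
    ∑ k ∈ Finset.range n, (if s k = true then (1 : ℝ≥0∞) else 0) = reds s n := by
  rw [Finset.sum_boole, reds, Nat.count_eq_card_filter_range]

lemma sum_draws_blue (s : ℕ → Bool) (n : ℕ) :
    ∑ k ∈ Finset.range n, (if s k = false then (1 : ℝ≥0∞) else 0) = blues s n := by
  rw [Finset.sum_boole, blues, Nat.count_eq_card_filter_range]

lemma IsMixed.sumUpTo_red (h : IsMixed s) (y : ℕ) :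
    sumUpTo s y (fun k => if s k = true then 1 else 0) = y + 1 := by
  obtain ⟨n, rfl, hn⟩ := h.exists_reds_eq y
  rw [sumUpTo_reds hn, sum_draws_red, reds_succ, if_pos hn, Nat.cast_add_one]

lemma IsMixed.sumUpTo_blue (h : IsMixed s) (y : ℕ) :
    sumUpTo s y (fun k => if s k = false then 1 else 0) = bluesBefore s y := by
  obtain ⟨n, rfl, hn⟩ := h.exists_reds_eq y
  rw [sumUpTo_reds hn, sum_draws_blue, bluesBefore_reds hn, blues_succ, hn]
  simp

lemma sumUpTo_iSup (s : ℕ → Bool) {u : ℕ → ℕ∞} (hu : Monotone u) (g : ℕ → ℝ≥0∞) :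
    sumUpTo s (⨆ j, u j) g = ⨆ j, sumUpTo s (u j) g := by
  have hterm : ∀ k, (if (reds s k : ℕ∞) ≤ ⨆ j, u j then g k else 0) =
      ⨆ j, if (reds s k : ℕ∞) ≤ u j then g k else 0 := fun k => by
    refine le_antisymm ?_ (iSup_le fun j => ?_)
    · split_ifs with hk
      · obtain ⟨j, hj⟩ := natCast_le_iSup_iff.1 hk
        exact le_iSup_of_le j (if_pos hj).ge
      · exact zero_le
    · split_ifs with hj hk hk
      exacts [le_rfl, absurd (hj.trans (le_iSup u j)) hk, zero_le, le_rfl]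
  have hmono : Monotone fun j k => if (reds s k : ℕ∞) ≤ u j then g k else 0 := fun i j hij k => by
    dsimp only
    split_ifs with hi hj hj
    exacts [le_rfl, absurd (hi.trans (hu hij)) hj, zero_le, le_rfl]
  simp only [sumUpTo, hterm, ← lintegral_count]
  exact lintegral_iSup (fun j => Measurable.of_discrete) hmono

lemma measurable_sumUpTo (y : ℕ∞) {g : ℕ → (ℕ → Bool) → ℝ≥0∞} (hg : ∀ k, Measurable (g k)) :
    Measurable fun s => sumUpTo s y (g · s) :=
  Measurable.tsum fun k => Measurable.ite (measurableSet_reds_le k y) (hg k) measurable_const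

lemma measurable_ite_draw_eq {g : (ℕ → Bool) → ℝ≥0∞} (hg : Measurable g) (k : ℕ) (c : Bool) :
    Measurable fun s => if s k = c then g s else 0 :=
  Measurable.ite (measurableSet_draw_eq k c) hg measurable_const

lemma lintegral_sumUpTo (ν : Measure (ℕ → Bool)) (y : ℕ∞) {g : ℕ → (ℕ → Bool) → ℝ≥0∞}
    (hg : ∀ k, Measurable (g k)) :
    ∫⁻ s, sumUpTo s y (g · s) ∂ν =
      ∑' k, ∫⁻ s, if (reds s k : ℕ∞) ≤ y then g k s else 0 ∂ν :=
  lintegral_tsum fun k =>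
    (Measurable.ite (measurableSet_reds_le k y) (hg k) measurable_const).aemeasurable

/-- The weights `(1 + t) ^ reds * (1 - t) ^ blues`, written with `r = 1 - t`: they form a martingale
for fair draws. -/
noncomputable def expWeight (t r : ℝ≥0∞) (s : ℕ → Bool) (n : ℕ) : ℝ≥0∞ :=
  (1 + t) ^ reds s n * r ^ blues s n

variable {t r : ℝ≥0∞}

lemma dependsOn_expWeight (t r : ℝ≥0∞) (n : ℕ) : DependsOn (expWeight t r · n) (Iio n) :=
  fun _ _ h =>
    congrArg₂ (fun i j => (1 + t) ^ i * r ^ j) (dependsOn_reds n h) (dependsOn_blues n h)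

lemma expWeight_le (hr : r ≤ 1) {y : ℕ} (h : reds s n ≤ y) : expWeight t r s n ≤ (1 + t) ^ y :=
  (mul_le_of_le_one_right' (pow_le_one' hr _)).trans (pow_le_pow_right₀ le_self_add h)

lemma expWeight_succ_of_red (t r : ℝ≥0∞) (h : s n = true) :
    expWeight t r s (n + 1) = (1 + t) * expWeight t r s n := by
  simp only [expWeight, reds_succ, blues_succ, h, if_true, Bool.true_eq_false, if_false, add_zero]
  ring

lemma expWeight_succ_of_blue (t r : ℝ≥0∞) (h : s n = false) :
    expWeight t r s (n + 1) = r * expWeight t r s n := by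
  simp only [expWeight, reds_succ, blues_succ, h, if_true, Bool.false_eq_true, if_false, add_zero]
  ring

lemma expWeight_add_sum_blue (htr : r + t = 1) (s : ℕ → Bool) (n : ℕ) :
    expWeight t r s n + ∑ k ∈ Finset.range n, (if s k = false then t * expWeight t r s k else 0) =
      1 + ∑ k ∈ Finset.range n, (if s k = true then t * expWeight t r s k else 0) := by
  induction n with
  | zero => simp [expWeight]
  | succ n ih =>
    rw [Finset.sum_range_succ, Finset.sum_range_succ, ← add_assoc 1, ← ih]
    cases hs : s n
    · have hstep : r * expWeight t r s n + t * expWeight t r s n = expWeight t r s n := by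
        rw [← add_mul, htr, one_mul]
      simp only [expWeight_succ_of_blue t r hs, if_true, Bool.false_eq_true, if_false, add_zero]
      rw [add_left_comm, hstep, add_comm]
    · simp only [expWeight_succ_of_red t r hs, if_true, Bool.true_eq_false, if_false, add_zero]
      ring

/-- The weight `r ^ y`, vanishing at `y = ⊤`. -/
noncomputable def geomWeight (r : ℝ≥0∞) (y : ℕ∞) : ℝ≥0∞ := if y = ⊤ then 0 else r ^ y.toNat

lemma geomWeight_top (r : ℝ≥0∞) : geomWeight r ⊤ = 0 := if_pos rfl

lemma geomWeight_natCast (r : ℝ≥0∞) (n : ℕ) : geomWeight r n = r ^ n := by simp [geomWeight]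

lemma geomWeight_le_one (hr : r ≤ 1) (y : ℕ∞) : geomWeight r y ≤ 1 := by
  unfold geomWeight
  split_ifs
  exacts [zero_le, pow_le_one' hr _]

lemma IsMixed.expWeight_add_sumUpTo_blue (h : IsMixed s) (htr : r + t = 1) (y : ℕ) :
    (1 + t) ^ (y + 1) * geomWeight r (bluesBefore s y) +
        sumUpTo s y (fun k => if s k = false then t * expWeight t r s k else 0) =
      1 + sumUpTo s y (fun k => if s k = true then t * expWeight t r s k else 0) := by
  obtain ⟨n, rfl, hn⟩ := h.exists_reds_eq y
  rw [sumUpTo_reds hn, sumUpTo_reds hn, ← expWeight_add_sum_blue htr,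
    expWeight_succ_of_red t r hn, bluesBefore_reds hn, geomWeight_natCast, expWeight, pow_succ',
    mul_assoc]

end SumUpTo

section Drift

open scoped ENNReal

/-- The expected drift `∑ₖ (2 q k - 1)` carried by the draws up to the `(y + 1)`-th red one, only
the positive terms being counted. -/
noncomputable def driftUpTo (ν : Measure (ℕ → Bool)) (q : ℕ → (ℕ → Bool) → ℝ) (y : ℕ∞) : ℝ≥0∞ :=
  ∫⁻ s, sumUpTo s y (fun k => ENNReal.ofReal (2 * q k s - 1)) ∂ν

variable {ν : Measure (ℕ → Bool)} {q : ℕ → (ℕ → Bool) → ℝ}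

lemma driftUpTo_mono (ν : Measure (ℕ → Bool)) (q : ℕ → (ℕ → Bool) → ℝ) :
    Monotone (driftUpTo ν q) :=
  fun _ _ hyz => lintegral_mono fun _ => sumUpTo_mono hyz fun _ _ => le_rfl

lemma driftUpTo_eq_zero (hq : ∀ n b, q n b ≤ 1 / 2) (y : ℕ∞) : driftUpTo ν q y = 0 := by
  have hzero : ∀ n b, ENNReal.ofReal (2 * q n b - 1) = 0 := fun n b =>
    ENNReal.ofReal_of_nonpos (by linarith [hq n b])
  simp [driftUpTo, sumUpTo, hzero]

namespace IsDrawLaw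

lemma measurable_drift (h : IsDrawLaw ν q) (y : ℕ∞) :
    Measurable fun s => sumUpTo s y fun k => ENNReal.ofReal (2 * q k s - 1) :=
  measurable_sumUpTo y fun k => (((h.measurable k).const_mul 2).sub_const 1).ennreal_ofReal

lemma driftUpTo_iSup (h : IsDrawLaw ν q) {u : ℕ → ℕ∞} (hu : Monotone u) :
    driftUpTo ν q (⨆ j, u j) = ⨆ j, driftUpTo ν q (u j) := by
  simp only [driftUpTo, sumUpTo_iSup _ hu]
  exact lintegral_iSup (fun j => h.measurable_drift (u j))
    fun _ _ hij _ => sumUpTo_mono (hu hij) fun _ _ => le_rfl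

lemma driftUpTo_add_le (h : IsDrawLaw ν q) {y : ℕ} {b : ℕ → Bool} {n : ℕ} (hb : y < reds b n) :
    driftUpTo ν q y + ENNReal.ofReal (2 * q n b - 1) * ν (PiNat.cylinder b n) ≤
      driftUpTo ν q ⊤ := by
  rw [← lintegral_indicator_const (measurableSet_cylinder b n), driftUpTo, driftUpTo,
    ← lintegral_add_left (h.measurable_drift y)]
  refine lintegral_mono fun s => ?_
  by_cases hs : s ∈ PiNat.cylinder b n
  · have hlast : (PiNat.cylinder b n).indicator (fun _ => ENNReal.ofReal (2 * q n b - 1)) s =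
        ∑' k, if k = n then ENNReal.ofReal (2 * q n s - 1) else 0 := by
      rw [tsum_ite_eq, indicator_of_mem hs, h.dependsOn n hs]
    have hred : reds s n = reds b n := dependsOn_reds n hs
    dsimp only
    rw [hlast, sumUpTo_top, sumUpTo, ← ENNReal.tsum_add]
    refine ENNReal.tsum_le_tsum fun k => ?_
    rcases eq_or_ne k n with rfl | hk
    · rw [if_neg, if_pos rfl, zero_add]
      rw [hred]
      exact_mod_cast hb.not_ge
    · rw [if_neg hk, add_zero]
      split_ifs
      exacts [le_rfl, zero_le]
  · simp only [indicator_of_notMem hs, add_zero]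
    exact sumUpTo_mono le_top fun _ _ => le_rfl

variable [IsProbabilityMeasure ν]

lemma lintegral_sumUpTo_draw (h : IsDrawLaw ν q) (y : ℕ∞) {g : ℕ → (ℕ → Bool) → ℝ≥0∞}
    (hg : ∀ k, DependsOn (g k) (Iio k)) (c : Bool) :
    ∫⁻ s, sumUpTo s y (fun k => if s k = c then g k s else 0) ∂ν =
      ∫⁻ s, sumUpTo s y
        (fun k => ENNReal.ofReal (if c = true then q k s else 1 - q k s) * g k s) ∂ν := by
  have hgm : ∀ k, Measurable (g k) := fun k => measurable_of_dependsOn_Iio (hg k)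
  have hqm : ∀ k, Measurable fun s => if c = true then q k s else 1 - q k s := fun k => by
    split_ifs
    exacts [h.measurable k, (h.measurable k).const_sub 1]
  rw [lintegral_sumUpTo ν y fun k => measurable_ite_draw_eq (hgm k) k c,
    lintegral_sumUpTo ν y fun k => (hqm k).ennreal_ofReal.fun_mul (hgm k)]
  refine tsum_congr fun k => ?_
  have hdep : ∀ a, DependsOn (fun s : ℕ → Bool =>
      if (reds s k : ℕ∞) ≤ y then (if a = c then g k s else 0) else 0) (Iio k) :=
    fun a s s' hs => by
      have hred : reds s k = reds s' k := dependsOn_reds k hs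
      simp only [hred, hg k hs]
  rw [h.lintegral_draw hdep]
  refine lintegral_congr fun s => ?_
  cases c <;> split_ifs <;> simp_all

lemma lintegral_sumUpTo_red_add (h : IsDrawLaw ν q) (y : ℕ∞) {g : ℕ → (ℕ → Bool) → ℝ≥0∞}
    (hg : ∀ k, DependsOn (g k) (Iio k)) :
    ∫⁻ s, sumUpTo s y (fun k => if s k = true then g k s else 0) ∂ν +
        ∫⁻ s, sumUpTo s y (fun k => ENNReal.ofReal (1 - 2 * q k s) * g k s) ∂ν =
      ∫⁻ s, sumUpTo s y (fun k => if s k = false then g k s else 0) ∂ν +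
        ∫⁻ s, sumUpTo s y (fun k => ENNReal.ofReal (2 * q k s - 1) * g k s) ∂ν := by
  have hmeas : ∀ φ : ℝ → ℝ, Measurable φ →
      Measurable fun s => sumUpTo s y fun k => ENNReal.ofReal (φ (q k s)) * g k s := fun φ hφ =>
    measurable_sumUpTo y fun k =>
      (hφ.comp (h.measurable k)).ennreal_ofReal.mul (measurable_of_dependsOn_Iio (hg k))
  rw [h.lintegral_sumUpTo_draw y hg, h.lintegral_sumUpTo_draw y hg,
    ← lintegral_add_right _ (hmeas (fun x => 1 - 2 * x) (by fun_prop)),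
    ← lintegral_add_right _ (hmeas (fun x => 2 * x - 1) (by fun_prop))]
  refine lintegral_congr fun s => ?_
  rw [← sumUpTo_add, ← sumUpTo_add]
  congr 1
  funext k
  obtain ⟨h0, h1⟩ := h.mem_Icc k s
  simp only [if_true, Bool.false_eq_true, if_false]
  rw [← add_mul, ← add_mul]
  congr 1
  rcases le_total (q k s) (1 / 2) with hq | hq
  · rw [ENNReal.ofReal_of_nonpos (p := 2 * q k s - 1) (by linarith), add_zero,
      ← ENNReal.ofReal_add h0 (by linarith)]
    congr 1
    ring
  · rw [ENNReal.ofReal_of_nonpos (p := 1 - 2 * q k s) (by linarith), add_zero,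
      ← ENNReal.ofReal_add (by linarith) (by linarith)]
    congr 1
    ring

lemma lintegral_bluesBefore_add_driftUpTo (h : IsDrawLaw ν q) (hν : ∀ᵐ s ∂ν, IsMixed s)
    (hq : ∀ n b, 1 / 2 ≤ q n b) (y : ℕ∞) :
    ∫⁻ s, (bluesBefore s y : ℝ≥0∞) ∂ν + driftUpTo ν q y = y + 1 := by
  rcases eq_or_ne y ⊤ with rfl | hy
  · have htop : ∀ᵐ s ∂ν, (bluesBefore s ⊤ : ℝ≥0∞) = ⊤ := hν.mono fun s hs => by
      rw [hs.bluesBefore_eq_top_iff.2 rfl, ENat.toENNReal_top]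
    simp [lintegral_congr_ae htop]
  lift y to ℕ using hy
  have hcomp := h.lintegral_sumUpTo_red_add y (g := fun _ _ => 1) fun _ _ _ _ => rfl
  have hneg : ∀ k s, ENNReal.ofReal (1 - 2 * q k s) = 0 := fun k s =>
    ENNReal.ofReal_of_nonpos (by linarith [hq k s])
  have hzero : ∀ s : ℕ → Bool, sumUpTo s y (fun _ => 0) = 0 := fun s => by simp [sumUpTo]
  have hred := lintegral_congr_ae (hν.mono fun s hs => hs.sumUpTo_red y)
  have hblue := lintegral_congr_ae (hν.mono fun s hs => hs.sumUpTo_blue y)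
  simp only [hneg, hzero, lintegral_zero, add_zero, mul_one, hred, hblue,
    lintegral_const, measure_univ] at hcomp
  exact hcomp.symm

lemma lintegral_sumUpTo_expWeight_red_ne_top (hν : ∀ᵐ s ∂ν, IsMixed s) {t r : ℝ≥0∞}
    (htr : r + t = 1) (y : ℕ) :
    ∫⁻ s, sumUpTo s y (fun k => if s k = true then t * expWeight t r s k else 0) ∂ν ≠ ⊤ := by
  have ht : t ≠ ⊤ := ne_top_of_le_ne_top ENNReal.one_ne_top (le_add_self.trans htr.le)
  have hr : r ≤ 1 := le_self_add.trans htr.le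
  refine ne_top_of_le_ne_top (b := t * (1 + t) ^ y * (y + 1)) (by finiteness) ?_
  calc ∫⁻ s, sumUpTo s y (fun k => if s k = true then t * expWeight t r s k else 0) ∂ν
      ≤ ∫⁻ _, t * (1 + t) ^ y * (y + 1) ∂ν := by
        refine lintegral_mono_ae (hν.mono fun s hs => ?_)
        rw [← hs.sumUpTo_red y, ← sumUpTo_const_mul]
        refine sumUpTo_mono le_rfl fun k hk => ?_
        split_ifs
        · rw [mul_one]
          gcongr
          exact expWeight_le hr (Nat.cast_le.1 hk)
        · exact zero_le
    _ = t * (1 + t) ^ y * (y + 1) := by simp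

lemma lintegral_geomWeight_add_blue (hν : ∀ᵐ s ∂ν, IsMixed s) {t r : ℝ≥0∞} (htr : r + t = 1)
    (y : ℕ) :
    (1 + t) ^ (y + 1) * ∫⁻ s, geomWeight r (bluesBefore s y) ∂ν +
        ∫⁻ s, sumUpTo s y (fun k => if s k = false then t * expWeight t r s k else 0) ∂ν =
      1 + ∫⁻ s, sumUpTo s y (fun k => if s k = true then t * expWeight t r s k else 0) ∂ν := by
  have ht : t ≠ ⊤ := ne_top_of_le_ne_top ENNReal.one_ne_top (le_add_self.trans htr.le)
  have hmeas : ∀ c, Measurable fun s => sumUpTo s y fun k =>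
      if s k = c then t * expWeight t r s k else 0 := fun c =>
    measurable_sumUpTo y fun k => measurable_ite_draw_eq
      ((measurable_of_dependsOn_Iio (dependsOn_expWeight t r k)).const_mul t) k c
  have hae := lintegral_congr_ae (hν.mono fun s hs => hs.expWeight_add_sumUpTo_blue htr y)
  rw [lintegral_add_right _ (hmeas false), lintegral_add_right _ (hmeas true),
    lintegral_const_mul' _ _ (by finiteness), lintegral_one, measure_univ] at hae
  exact hae

lemma mul_lintegral_geomWeight_bluesBefore_le (h : IsDrawLaw ν q) (hν : ∀ᵐ s ∂ν, IsMixed s)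
    {t r : ℝ≥0∞} (htr : r + t = 1) (y : ℕ) :
    (1 + t) ^ (y + 1) * ∫⁻ s, geomWeight r (bluesBefore s y) ∂ν ≤
      1 + t * (1 + t) ^ y * driftUpTo ν q y := by
  have hbalance := lintegral_geomWeight_add_blue hν htr y
  have hred := lintegral_sumUpTo_expWeight_red_ne_top hν htr y
  set R := ∫⁻ s, sumUpTo s y (fun k => if s k = true then t * expWeight t r s k else 0) ∂ν
  set B := ∫⁻ s, sumUpTo s y (fun k => if s k = false then t * expWeight t r s k else 0) ∂ν
  have hdep : ∀ k, DependsOn (fun s => t * expWeight t r s k) (Iio k) := fun k _ _ hs =>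
    congrArg (t * ·) (dependsOn_expWeight t r k hs)
  have hRB : R ≤ B + t * (1 + t) ^ y * driftUpTo ν q y := by
    calc R ≤ B + ∫⁻ s, sumUpTo s y
          (fun k => ENNReal.ofReal (2 * q k s - 1) * (t * expWeight t r s k)) ∂ν :=
          le_self_add.trans (h.lintegral_sumUpTo_red_add y hdep).le
      _ ≤ B + t * (1 + t) ^ y * driftUpTo ν q y := by
          rw [driftUpTo, ← lintegral_const_mul _ (h.measurable_drift y)]
          gcongr with s
          rw [← sumUpTo_const_mul]
          refine sumUpTo_mono le_rfl fun k hk => ?_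
          rw [mul_comm]
          gcongr
          exact expWeight_le (le_self_add.trans htr.le) (Nat.cast_le.1 hk)
  have hB : B ≠ ⊤ := ne_top_of_le_ne_top (by finiteness) (le_add_self.trans hbalance.le)
  refine (ENNReal.add_le_add_iff_right hB).1 ?_
  rw [hbalance, add_assoc, add_comm _ B]
  gcongr

lemma lintegral_geomWeight_bluesBefore_le (h : IsDrawLaw ν q) (hν : ∀ᵐ s ∂ν, IsMixed s) (m : ℕ)
    (y : ℕ∞) :
    (m + 2) * ∫⁻ s, geomWeight (m / (m + 1)) (bluesBefore s y) ∂ν ≤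
      (m + 1) * geomWeight ((m + 1) / (m + 2)) y + driftUpTo ν q y := by
  rcases eq_or_ne y ⊤ with rfl | hy
  · have hzero : ∀ᵐ s ∂ν, geomWeight (m / (m + 1)) (bluesBefore s ⊤) = 0 := hν.mono fun s hs => by
      rw [hs.bluesBefore_eq_top_iff.2 rfl, geomWeight_top]
    simp [lintegral_congr_ae hzero]
  lift y to ℕ using hy
  have h1 : (m + 1 : ℝ≥0∞) ≠ 0 := by simp
  have h1' : (m + 1 : ℝ≥0∞) ≠ ⊤ := by finiteness
  have htr : m / (m + 1) + (m + 1 : ℝ≥0∞)⁻¹ = 1 := by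
    rw [← one_div, ← ENNReal.add_div, ENNReal.div_self h1 h1']
  have ht : 1 + (m + 1 : ℝ≥0∞)⁻¹ = (m + 2) / (m + 1) := by
    calc 1 + (m + 1 : ℝ≥0∞)⁻¹ = (m + 1) / (m + 1) + 1 / (m + 1) := by
          rw [ENNReal.div_self h1 h1', one_div]
      _ = (m + 2) / (m + 1) := by rw [← ENNReal.add_div, add_assoc, one_add_one_eq_two]
  have hinv : ((m + 1) / (m + 2) * ((m + 2) / (m + 1)) : ℝ≥0∞) = 1 := by
    rw [← ENNReal.inv_div (by simp) (by simp), ENNReal.inv_mul_cancel]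
    · simp
    · finiteness
  have hbound := h.mul_lintegral_geomWeight_bluesBefore_le hν htr y
  rw [ht] at hbound
  set I := ∫⁻ s, geomWeight (m / (m + 1)) (bluesBefore s y) ∂ν
  set a : ℝ≥0∞ := (m + 1) / (m + 2)
  set b : ℝ≥0∞ := (m + 2) / (m + 1) with hb
  have hpow : a ^ y * b ^ y = 1 := by rw [← mul_pow, hinv, one_pow]
  calc (m + 2) * I = (m + 1) * b * (a ^ y * b ^ y) * I := by
        rw [hpow, mul_one, hb, ENNReal.mul_div_cancel h1 h1']
    _ = (m + 1) * a ^ y * (b ^ (y + 1) * I) := by ring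
    _ ≤ (m + 1) * a ^ y * (1 + (m + 1 : ℝ≥0∞)⁻¹ * b ^ y * driftUpTo ν q y) := by gcongr
    _ = (m + 1) * a ^ y + (m + 1) * (m + 1 : ℝ≥0∞)⁻¹ * (a ^ y * b ^ y) * driftUpTo ν q y := by ring
    _ = (m + 1) * geomWeight a y + driftUpTo ν q y := by
        rw [hpow, ENNReal.mul_inv_cancel h1 h1', mul_one, one_mul, geomWeight_natCast]

end IsDrawLaw

end Drift

/-! ### Shifts of independent sequences -/

section Shift

variable {Ω E : Type*} [MeasurableSpace E]

lemma measurable_shift_iSup (S : ℕ → Ω → E) (n : ℕ) :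
    Measurable[⨆ i, ⨆ (_ : n ≤ i), MeasurableSpace.comap (S i) inferInstance]
      fun ω i => S (i + n) ω := by
  refine @measurable_pi_lambda _ _ _ (_) _ _ fun i => ?_
  rw [measurable_iff_comap_le]
  exact le_iSup₂_of_le (f := fun i (_ : n ≤ i) => MeasurableSpace.comap (S i) inferInstance)
    (i + n) (Nat.le_add_left n i) le_rfl

variable [MeasurableSpace Ω] {μ : Measure Ω} {S : ℕ → Ω → E}

lemma measurable_shift (hS : ∀ i, Measurable (S i)) (n : ℕ) : Measurable fun ω i => S (i + n) ω :=
  measurable_pi_lambda _ fun i => hS (i + n)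

lemma iIndepFun_shift (hi : iIndepFun S μ) (n : ℕ) : iIndepFun (fun i => S (i + n)) μ :=
  hi.precomp (g := fun i : ℕ => i + n) (add_left_injective n)

lemma indepFun_zero_shift (hS : ∀ i, Measurable (S i)) (hi : iIndepFun S μ) :
    IndepFun (S 0) (fun ω i => S (i + 1) ω) μ := by
  have h := indep_iSup_of_disjoint (fun i => (hS i).comap_le) hi (S := {0}) (T := {i | 1 ≤ i})
    (by simp)
  refine indep_of_indep_of_le_left (indep_of_indep_of_le_right h ?_) (by simp)
  exact (measurable_shift_iSup S 1).comap_le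

lemma lintegral_shift_eq (hS : ∀ i, Measurable (S i)) (hi : iIndepFun S μ) {ν : Measure E}
    (hν : ∀ i, μ.map (S i) = ν) {F : (ℕ → E) → ENNReal} (hF : Measurable F) (n : ℕ) :
    ∫⁻ ω, F (fun i => S (i + n) ω) ∂μ = ∫⁻ ω, F (fun i => S i ω) ∂μ := by
  have hmap : μ.map (fun ω i => S (i + n) ω) = μ.map (fun ω i => S i ω) := by
    rw [hi.map_fun_eq_infinitePi_map hS,
      (iIndepFun_shift hi n).map_fun_eq_infinitePi_map fun i => hS (i + n)]
    simp only [hν]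
  rw [← lintegral_map hF (measurable_shift hS n), hmap,
    lintegral_map hF (measurable_pi_lambda _ hS)]

variable [IsProbabilityMeasure μ]

lemma lintegral_zero_shift (hS : ∀ i, Measurable (S i)) (hi : iIndepFun S μ)
    {Φ : E × (ℕ → E) → ENNReal} (hΦ : Measurable Φ) :
    ∫⁻ ω, Φ (S 0 ω, fun i => S (i + 1) ω) ∂μ =
      ∫⁻ ω, ∫⁻ s, Φ (s, fun i => S (i + 1) ω) ∂(μ.map (S 0)) ∂μ := by
  have hT := measurable_shift hS 1
  have hprod := (indepFun_iff_map_prod_eq_prod_map_map (hS 0).aemeasurable hT.aemeasurable).1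
    (indepFun_zero_shift hS hi)
  have := Measure.isProbabilityMeasure_map (μ := μ) (hS 0).aemeasurable
  have := Measure.isProbabilityMeasure_map (μ := μ) hT.aemeasurable
  rw [← lintegral_map (μ := μ) (g := fun ω => (S 0 ω, fun i => S (i + 1) ω)) hΦ
    ((hS 0).prodMk hT), hprod, lintegral_prod_symm _ hΦ.aemeasurable, lintegral_map _ hT]
  exact hΦ.lintegral_prod_left'

lemma ae_mem_or_ae_notMem_of_shift_invariant (hS : ∀ i, Measurable (S i)) (hi : iIndepFun S μ)
    {A : Set (ℕ → E)} (hA : MeasurableSet A)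
    (hinv : ∀ᵐ ω ∂μ, ∀ n, (fun i => S (i + n) ω) ∈ A ↔ (fun i => S i ω) ∈ A) :
    (∀ᵐ ω ∂μ, (fun i => S i ω) ∈ A) ∨ ∀ᵐ ω ∂μ, (fun i => S i ω) ∉ A := by
  let B : ℕ → Set Ω := fun n => {ω | (fun i => S (i + n) ω) ∈ A}
  have htail : MeasurableSet[limsup (fun i => MeasurableSpace.comap (S i) inferInstance) atTop]
      (limsup B atTop) := by
    rw [limsup_eq_iInf_iSup_of_nat, MeasurableSpace.measurableSet_iInf]
    intro N
    rw [← limsup_nat_add B N]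
    refine @MeasurableSet.measurableSet_limsup _ (_) _ fun n => ?_
    refine (measurable_shift_iSup S (n + N)).mono (iSup_mono fun i => ?_) le_rfl hA
    exact iSup_const_mono fun h => (Nat.le_add_left N n).trans h
  have hmeas : NullMeasurableSet (limsup B atTop) μ :=
    (MeasurableSet.measurableSet_limsup fun n => measurable_shift hS n hA).nullMeasurableSet
  have hae : ∀ᵐ ω ∂μ, ω ∈ limsup B atTop ↔ (fun i => S i ω) ∈ A := by
    filter_upwards [hinv] with ω hω
    rw [mem_limsup_iff_frequently_mem]
    simp [B, hω]
  rcases measure_zero_or_one_of_measurableSet_limsup_atTop (fun i => (hS i).comap_le) hi htail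
    with h | h
  · right
    filter_upwards [hae, measure_eq_zero_iff_ae_notMem.1 h] with ω hω h'
    rwa [← hω]
  · left
    filter_upwards [hae, (mem_ae_iff_prob_eq_one₀ hmeas).2 h] with ω hω h'
    rwa [← hω]

end Shift

/-! ### The backward recursion with independent draws -/

lemma le_of_forall_add_two_mul_le {v : ℕ → ENNReal} {e : ENNReal} (m : ℕ) (hv : ∀ n, v n ≤ 1)
    (h : ∀ n, ((m + n : ℕ) + 2) * v n ≤ ((m + n : ℕ) + 1) * v (n + 1) + e) : v 0 ≤ e := by
  rcases eq_or_ne e ⊤ with rfl | he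
  · exact le_top
  have hv' : ∀ n, v n ≠ ⊤ := fun n => ne_top_of_le_ne_top ENNReal.one_ne_top (hv n)
  let w : ℕ → ℝ := fun n => ((v n).toReal - e.toReal) / (m + n + 1)
  have hmono : Monotone w := monotone_nat_of_le_succ fun n => by
    have hn := ENNReal.toReal_mono (by finiteness [hv' (n + 1)]) (h n)
    rw [ENNReal.toReal_add (by finiteness [hv' (n + 1)]) he, ENNReal.toReal_mul,
      ENNReal.toReal_mul, ENNReal.toReal_add (by simp) (by simp),
      ENNReal.toReal_add (by simp) (by simp)] at hn
    simp only [ENNReal.toReal_natCast, ENNReal.toReal_ofNat, ENNReal.toReal_one] at hn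
    push_cast at hn
    simp only [w, Nat.cast_add_one]
    rw [div_le_div_iff₀ (by positivity) (by positivity)]
    linarith
  have hbound : ∀ n, w n ≤ 1 / (n + 1) := fun n => by
    have hvn : (v n).toReal ≤ 1 := ENNReal.toReal_mono ENNReal.one_ne_top (hv n)
    have he0 : 0 ≤ e.toReal := ENNReal.toReal_nonneg
    calc w n ≤ 1 / (m + n + 1) := by
          simp only [w]
          gcongr
          linarith
      _ ≤ 1 / (n + 1) := by
          gcongr
          linarith [(Nat.cast_nonneg m : (0 : ℝ) ≤ m)]
  have hw : w 0 ≤ 0 := ge_of_tendsto' tendsto_one_div_add_atTop_nhds_zero_nat fun n =>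
    (hmono (Nat.zero_le n)).trans (hbound n)
  have hsub : (v 0).toReal - e.toReal ≤ 0 := by
    by_contra! hpos
    exact hw.not_gt (by simp only [w]; positivity)
  exact (ENNReal.toReal_le_toReal (hv' 0) he).1 (sub_nonpos.1 hsub)

lemma le_one_of_add_le_add_one {e d : ℕ → ENNReal} (he : e 0 ≠ ⊤) (hd : Monotone d)
    (h : ∀ j, e (j + 1) + d j ≤ e j + 1) (j : ℕ) : d j ≤ 1 := by
  have hfin : ∀ j, e j ≠ ⊤ := fun j => by
    induction j with
    | zero => exact he
    | succ j ih => exact ne_top_of_le_ne_top (by finiteness) (le_self_add.trans (h j))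
  have hdj : d j ≠ ⊤ := ne_top_of_le_ne_top (by finiteness [hfin j]) (le_add_self.trans (h j))
  have hsum : ∀ k : ℕ, e (j + k) + k * d j ≤ e j + k := fun k => by
    induction k with
    | zero => simp
    | succ k ih =>
      calc e (j + (k + 1)) + (k + 1 : ℕ) * d j = e (j + k + 1) + d j + k * d j := by
            rw [← add_assoc]; push_cast; ring
        _ ≤ e (j + k + 1) + d (j + k) + k * d j := by
            gcongr
            exact hd (Nat.le_add_right j k)
        _ ≤ e (j + k) + 1 + k * d j := add_le_add_left (h (j + k)) _
        _ = e (j + k) + k * d j + 1 := by ring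
        _ ≤ e j + k + 1 := by gcongr
        _ = e j + (k + 1 : ℕ) := by push_cast; ring
  have hreal : ∀ k : ℕ, k * ((d j).toReal - 1) ≤ (e j).toReal := fun k => by
    have hk := ENNReal.toReal_mono (by finiteness [hfin j]) (le_add_self.trans (hsum k))
    rw [ENNReal.toReal_mul, ENNReal.toReal_add (hfin j) (by simp), ENNReal.toReal_natCast] at hk
    linarith
  have hle : (d j).toReal ≤ 1 := by
    by_contra! hlt
    obtain ⟨k, hk⟩ := exists_nat_gt ((e j).toReal / ((d j).toReal - 1))
    rw [div_lt_iff₀ (sub_pos.2 hlt)] at hk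
    exact (hreal k).not_gt hk
  exact (ENNReal.toReal_le_toReal hdj ENNReal.one_ne_top).1 hle

section BackwardLim

variable {Ω : Type*} [MeasurableSpace Ω] {μ : Measure Ω} [IsProbabilityMeasure μ]
  {S : ℕ → Ω → ℕ → Bool} {q : ℕ → ℕ → (ℕ → Bool) → ℝ} {ν : Measure (ℕ → Bool)}

lemma backwardLim_shift_lt_top_iff {T : ℕ → ℕ → Bool} (hT : ∀ i, IsMixed (T i)) (n : ℕ) :
    backwardLim (fun i => T (i + n)) < ⊤ ↔ backwardLim T < ⊤ := by
  induction n generalizing T with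
  | zero => rfl
  | succ n ih =>
    rw [backwardLim_eq_bluesBefore T, lt_top_iff_ne_top (a := bluesBefore _ _), ne_eq,
      (hT 0).bluesBefore_eq_top_iff, ← ne_eq, ← lt_top_iff_ne_top, ← ih fun i => hT (i + 1)]
    simp only [add_assoc]

lemma ae_backwardLim_eq_top_or_ae_lt_top (hS : ∀ i, Measurable (S i)) (hi : iIndepFun S μ)
    (hmixed : ∀ i, ∀ᵐ ω ∂μ, IsMixed (S i ω)) :
    (∀ᵐ ω ∂μ, backwardLim (fun i => S i ω) = ⊤) ∨
      ∀ᵐ ω ∂μ, backwardLim (fun i => S i ω) < ⊤ := by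
  have hA : MeasurableSet {T : ℕ → ℕ → Bool | backwardLim T < ⊤} :=
    measurable_backwardLim (MeasurableSet.of_discrete (s := Iio ⊤))
  have hinv : ∀ᵐ ω ∂μ, ∀ n, backwardLim (fun i => S (i + n) ω) < ⊤ ↔
      backwardLim (fun i => S i ω) < ⊤ := by
    filter_upwards [ae_all_iff.2 hmixed] with ω hω n using
      backwardLim_shift_lt_top_iff (T := fun i => S i ω) hω n
  refine (ae_mem_or_ae_notMem_of_shift_invariant hS hi hA hinv).symm.imp_left fun h => ?_
  filter_upwards [h] with ω hω using not_lt_top_iff.1 hω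

lemma measurable_geomWeight (r : ENNReal) : Measurable (geomWeight r) := Measurable.of_discrete

lemma measurable_driftUpTo (ν : Measure (ℕ → Bool)) (p : ℕ → (ℕ → Bool) → ℝ) :
    Measurable (driftUpTo ν p) := Measurable.of_discrete

lemma lintegral_geomWeight_backwardLim_step (hS : ∀ i, Measurable (S i)) (hi : iIndepFun S μ)
    {p : ℕ → (ℕ → Bool) → ℝ} (hp : IsDrawLaw (μ.map (S 0)) p)
    (hmixed : ∀ᵐ s ∂μ.map (S 0), IsMixed s) (m : ℕ) :
    (m + 2) * ∫⁻ ω, geomWeight (m / (m + 1)) (backwardLim fun i => S i ω) ∂μ ≤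
      (m + 1) * ∫⁻ ω, geomWeight ((m + 1) / (m + 2)) (backwardLim fun i => S (i + 1) ω) ∂μ +
        ∫⁻ ω, driftUpTo (μ.map (S 0)) p (backwardLim fun i => S (i + 1) ω) ∂μ := by
  have := Measure.isProbabilityMeasure_map (μ := μ) (hS 0).aemeasurable
  have hL : Measurable fun ω => backwardLim fun i => S (i + 1) ω :=
    measurable_backwardLim.comp (measurable_shift hS 1)
  have hΦ : Measurable fun P : (ℕ → Bool) × (ℕ → ℕ → Bool) =>
      geomWeight (m / (m + 1)) (bluesBefore P.1 (backwardLim P.2)) :=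
    (measurable_geomWeight _).comp (measurable_bluesBefore.comp
      (measurable_fst.prodMk (measurable_backwardLim.comp measurable_snd)))
  have hfst : ∫⁻ ω, geomWeight (m / (m + 1)) (backwardLim fun i => S i ω) ∂μ = ∫⁻ ω, ∫⁻ s,
      geomWeight (m / (m + 1)) (bluesBefore s (backwardLim fun i => S (i + 1) ω)) ∂μ.map (S 0) ∂μ :=
    (lintegral_congr fun ω => by rw [backwardLim_eq_bluesBefore]).trans
      (lintegral_zero_shift hS hi hΦ)
  rw [hfst, ← lintegral_const_mul' _ _ (by finiteness), ← lintegral_const_mul' _ _ (by finiteness),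
    ← lintegral_add_right (g := fun ω => driftUpTo _ p (backwardLim fun i => S (i + 1) ω)) _
      ((measurable_driftUpTo _ p).comp hL)]
  exact lintegral_mono fun ω => hp.lintegral_geomWeight_bluesBefore_le hmixed m _

lemma lintegral_geomWeight_backwardLim_le (hS : ∀ i, Measurable (S i)) (hi : iIndepFun S μ)
    (hq : ∀ i, IsDrawLaw (μ.map (S i)) (q i)) (hmixed : ∀ i, ∀ᵐ s ∂μ.map (S i), IsMixed s)
    {e : ENNReal}
    (he : ∀ i, ∫⁻ ω, driftUpTo (μ.map (S i)) (q i) (backwardLim fun j => S (j + (i + 1)) ω) ∂μ ≤ e)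
    (m : ℕ) : ∫⁻ ω, geomWeight (m / (m + 1)) (backwardLim fun i => S i ω) ∂μ ≤ e := by
  refine le_of_forall_add_two_mul_le (v := fun n => ∫⁻ ω,
    geomWeight ((m + n : ℕ) / ((m + n : ℕ) + 1)) (backwardLim fun i => S (i + n) ω) ∂μ)
    m (fun n => ?_) fun n => ?_
  · calc _ ≤ ∫⁻ _, 1 ∂μ := lintegral_mono fun ω =>
          geomWeight_le_one (ENNReal.div_le_of_le_mul (by simp)) _
      _ = 1 := by simp
  · have hstep := lintegral_geomWeight_backwardLim_step (S := fun i => S (i + n))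
      (fun i => hS (i + n)) (iIndepFun_shift hi n) (p := q n) (by simpa using hq n)
      (by simpa using hmixed n) (m + n)
    simp only [add_assoc, zero_add, add_comm 1 n] at hstep
    refine hstep.trans ?_
    push_cast
    simp only [add_assoc, one_add_one_eq_two]
    gcongr
    exact he n

lemma ae_backwardLim_eq_top_of_le_half (hS : ∀ i, Measurable (S i)) (hi : iIndepFun S μ)
    (hq : ∀ i, IsDrawLaw (μ.map (S i)) (q i)) (hmixed : ∀ i, ∀ᵐ s ∂μ.map (S i), IsMixed s)
    (hhalf : ∀ i n b, q i n b ≤ 1 / 2) : ∀ᵐ ω ∂μ, backwardLim (fun i => S i ω) = ⊤ := by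
  have hzero := lintegral_geomWeight_backwardLim_le hS hi hq hmixed (e := 0)
    (fun i => by simp [driftUpTo_eq_zero (hhalf i)]) 1
  have hmeas : Measurable fun ω => geomWeight ((1 : ℕ) / ((1 : ℕ) + 1)) (backwardLim (S · ω)) :=
    (measurable_geomWeight _).comp (measurable_backwardLim.comp (measurable_pi_lambda _ hS))
  filter_upwards [(lintegral_eq_zero_iff hmeas).1 (nonpos_iff_eq_zero.1 hzero)] with ω hω
  by_contra hne
  lift backwardLim fun i => S i ω to ℕ using hne with y
  simp [geomWeight_natCast] at hω

lemma lintegral_backward_succ_add_driftUpTo {p : ℕ → (ℕ → Bool) → ℝ} (hS : ∀ i, Measurable (S i))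
    (hi : iIndepFun S μ) (hν : ∀ i, μ.map (S i) = ν) (hp : IsDrawLaw ν p)
    (hmixed : ∀ᵐ s ∂ν, IsMixed s) (hhalf : ∀ n b, 1 / 2 ≤ p n b) (j : ℕ) :
    ∫⁻ ω, (backward (j + 1) fun i => S i ω : ENNReal) ∂μ +
        ∫⁻ ω, driftUpTo ν p (backward j fun i => S i ω) ∂μ =
      ∫⁻ ω, (backward j fun i => S i ω : ENNReal) ∂μ + 1 := by
  have : IsProbabilityMeasure ν := hν 0 ▸ Measure.isProbabilityMeasure_map (hS 0).aemeasurable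
  have hcast : Measurable fun y : ℕ∞ => (y : ENNReal) := Measurable.of_discrete
  have hΦ : Measurable fun P : (ℕ → Bool) × (ℕ → ℕ → Bool) =>
      (bluesBefore P.1 (backward j P.2) : ENNReal) := hcast.comp (measurable_bluesBefore.comp
    (measurable_fst.prodMk ((measurable_backward j).comp measurable_snd)))
  have hsucc : ∫⁻ ω, (backward (j + 1) fun i => S i ω : ENNReal) ∂μ =
      ∫⁻ ω, ∫⁻ s, (bluesBefore s (backward j fun i => S (i + 1) ω) : ENNReal) ∂ν ∂μ := by
    rw [← hν 0]
    exact lintegral_zero_shift hS hi hΦ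
  rw [hsucc, ← lintegral_shift_eq (F := fun T => driftUpTo ν p (backward j T)) hS hi hν
      ((measurable_driftUpTo ν p).comp (measurable_backward j)) 1,
    ← lintegral_shift_eq (F := fun T => (backward j T : ENNReal)) hS hi hν
      (hcast.comp (measurable_backward j)) 1,
    ← lintegral_add_right (g := fun ω => driftUpTo ν p (backward j fun i => S (i + 1) ω)) _
    ((measurable_driftUpTo ν p).comp ((measurable_backward j).comp (measurable_shift hS 1)))]
  simp only [hp.lintegral_bluesBefore_add_driftUpTo hmixed hhalf]
  rw [lintegral_add_right _ measurable_const]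
  simp

lemma driftUpTo_top_le_one {p : ℕ → (ℕ → Bool) → ℝ} (hS : ∀ i, Measurable (S i))
    (hi : iIndepFun S μ) (hν : ∀ i, μ.map (S i) = ν) (hp : IsDrawLaw ν p)
    (hmixed : ∀ᵐ s ∂ν, IsMixed s) (hhalf : ∀ n b, 1 / 2 ≤ p n b)
    (htop : ∀ᵐ ω ∂μ, backwardLim (fun i => S i ω) = ⊤) : driftUpTo ν p ⊤ ≤ 1 := by
  let d : ℕ → ENNReal := fun j => ∫⁻ ω, driftUpTo ν p (backward j fun i => S i ω) ∂μ
  have hmeas : ∀ j, Measurable fun ω => driftUpTo ν p (backward j fun i => S i ω) := fun j =>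
    (measurable_driftUpTo ν p).comp ((measurable_backward j).comp (measurable_pi_lambda _ hS))
  have hmono : ∀ ω, Monotone fun j => driftUpTo ν p (backward j fun i => S i ω) := fun ω =>
    (driftUpTo_mono ν p).comp (backward_mono fun i => S i ω)
  have hsup : ⨆ j, d j = driftUpTo ν p ⊤ := by
    rw [← lintegral_iSup hmeas fun i j hij ω => hmono ω hij,
      lintegral_congr_ae (g := fun _ => driftUpTo ν p ⊤)]
    · simp
    · filter_upwards [htop] with ω hω
      rw [← hω, backwardLim, hp.driftUpTo_iSup (backward_mono _)]
  rw [← hsup]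
  exact iSup_le (le_one_of_add_le_add_one
    (e := fun j => ∫⁻ ω, (backward j fun i => S i ω : ENNReal) ∂μ) (by simp [backward])
    (fun i j hij => lintegral_mono fun ω => hmono ω hij)
    fun j => (lintegral_backward_succ_add_driftUpTo hS hi hν hp hmixed hhalf j).le)

lemma tendsto_geomWeight {y : ℕ∞} (hy : y < ⊤) :
    Tendsto (fun m : ℕ => geomWeight (m / (m + 1)) y) atTop (𝓝 1) := by
  lift y to ℕ using hy.ne
  have hratio : Tendsto (fun m : ℕ => (m / (m + 1) : ENNReal)) atTop (𝓝 1) := by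
    have h := ENNReal.tendsto_ofReal (tendsto_natCast_div_add_atTop (1 : ℝ))
    rw [ENNReal.ofReal_one] at h
    refine h.congr fun m => ?_
    rw [ENNReal.ofReal_div_of_pos (by positivity), ENNReal.ofReal_add (by simp) (by simp)]
    simp
  simpa only [geomWeight_natCast, one_pow] using ENNReal.Tendsto.pow hratio (n := y)

lemma one_le_lintegral_driftUpTo_backwardLim {p : ℕ → (ℕ → Bool) → ℝ} (hS : ∀ i, Measurable (S i))
    (hi : iIndepFun S μ) (hν : ∀ i, μ.map (S i) = ν) (hp : IsDrawLaw ν p)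
    (hmixed : ∀ᵐ s ∂ν, IsMixed s) (hlim : ∀ᵐ ω ∂μ, backwardLim (fun i => S i ω) < ⊤) :
    1 ≤ ∫⁻ ω, driftUpTo ν p (backwardLim fun i => S i ω) ∂μ := by
  have hle := lintegral_geomWeight_backwardLim_le hS hi (q := fun _ => p) (fun i => hν i ▸ hp)
    (fun i => hν i ▸ hmixed) fun i => by
      rw [hν i, lintegral_shift_eq hS hi hν
        (F := fun T => driftUpTo ν p (backwardLim T))
        ((measurable_driftUpTo ν p).comp measurable_backwardLim) (i + 1)]
  have htend : Tendsto (fun m : ℕ => ∫⁻ ω, geomWeight (m / (m + 1)) (backwardLim fun i => S i ω) ∂μ)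
      atTop (𝓝 (∫⁻ _, 1 ∂μ)) :=
    tendsto_lintegral_of_dominated_convergence (fun _ => 1)
      (fun m => (measurable_geomWeight _).comp
        (measurable_backwardLim.comp (measurable_pi_lambda _ hS)))
      (fun m => Eventually.of_forall fun ω =>
        geomWeight_le_one (ENNReal.div_le_of_le_mul (by simp)) _)
      (by simp) (hlim.mono fun ω hω => tendsto_geomWeight hω)
  rw [lintegral_const, measure_univ, mul_one] at htend
  exact le_of_tendsto' htend hle

lemma not_ae_backwardLim_lt_top {p : ℕ → (ℕ → Bool) → ℝ} (hS : ∀ i, Measurable (S i))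
    (hi : iIndepFun S μ) (hν : ∀ i, μ.map (S i) = ν) (hp : IsDrawLaw ν p)
    (hmixed : ∀ᵐ s ∂ν, IsMixed s) (hdrift : ∀ y : ℕ, driftUpTo ν p y < 1) :
    ¬ ∀ᵐ ω ∂μ, backwardLim (fun i => S i ω) < ⊤ := fun hlim => by
  have hlt : ∀ᵐ ω ∂μ, driftUpTo ν p (backwardLim fun i => S i ω) < 1 := by
    filter_upwards [hlim] with ω hω
    lift backwardLim fun i => S i ω to ℕ using hω.ne with y
    exact hdrift y
  have hne : ∫⁻ ω, driftUpTo ν p (backwardLim fun i => S i ω) ∂μ ≠ ⊤ :=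
    ne_top_of_le_ne_top (by simp) (lintegral_mono_ae (hlt.mono fun _ => le_of_lt))
  have h := lintegral_strict_mono (IsProbabilityMeasure.ne_zero μ) aemeasurable_const hne hlt
  rw [lintegral_const, measure_univ, mul_one] at h
  exact h.not_ge (one_le_lintegral_driftUpTo_backwardLim hS hi hν hp hmixed hlim)

end BackwardLim

/-! ### Urn processes -/

lemma setIntegral_eq_measureReal_inter_of_condExp {Ω : Type*} {m m₀ : MeasurableSpace Ω}
    {μ : Measure Ω} [IsFiniteMeasure μ] (hm : m ≤ m₀) {A B : Set Ω} {g : Ω → ℝ}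
    (hA : MeasurableSet[m] A) (hB : MeasurableSet B) (hg : μ⟦B | m⟧ =ᵐ[μ] g) :
    ∫ ω in A, g ω ∂μ = μ.real (A ∩ B) := by
  rw [← setIntegral_congr_ae (hm A hA) (hg.mono fun ω hω _ => hω),
    setIntegral_condExp hm ((integrable_const (1 : ℝ)).indicator hB) hA, setIntegral_indicator hB,
    setIntegral_const, smul_eq_mul, mul_one]

section Urn

variable {a l t : ℝ} {f : ℝ → ℝ} {α : ℕ → ℝ} {k n : ℕ}

open Classical in
/-- The colours of the balls drawn along the proportions `α` of an urn of initial weight `l`. -/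
noncomputable def draws (l : ℝ) (α : ℕ → ℝ) (k : ℕ) : Bool :=
  decide (α (k + 1) = redUpdate (α k) (l + k))

lemma draws_eq_true_iff : draws l α k = true ↔ α (k + 1) = redUpdate (α k) (l + k) := by
  simp [draws]

/-- The proportion of red balls after `n` draws with colours `s`, in an urn of initial weight `l`
and initial proportion `a`. -/
noncomputable def urnState (a l : ℝ) (n : ℕ) (s : ℕ → Bool) : ℝ := (l * a + reds s n) / (l + n)

lemma urnState_mem_Icc (ha : a ∈ Icc (0 : ℝ) 1) (hl : 0 < l) (n : ℕ) (s : ℕ → Bool) :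
    urnState a l n s ∈ Icc (0 : ℝ) 1 := by
  have hreds : (reds s n : ℝ) ≤ n := by exact_mod_cast Nat.count_le _
  have hla := mul_le_of_le_one_right hl.le ha.2
  have hla' := mul_nonneg hl.le ha.1
  exact ⟨by unfold urnState; positivity, (div_le_one (by positivity)).2 (by linarith)⟩

lemma urnState_zero (hl : 0 < l) (s : ℕ → Bool) : urnState a l 0 s = a := by
  simp [urnState, hl.ne']

lemma urnState_succ (hl : 0 < l) (n : ℕ) (s : ℕ → Bool) : urnState a l (n + 1) s =
    if s n = true then redUpdate (urnState a l n s) (l + n)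
    else blueUpdate (urnState a l n s) (l + n) := by
  have hn : l + (n : ℝ) ≠ 0 := by positivity
  unfold urnState redUpdate blueUpdate
  rw [reds_succ, mul_div_cancel₀ _ hn]
  split_ifs <;> simp [add_assoc]

lemma dependsOn_urnState (a l : ℝ) (n : ℕ) : DependsOn (urnState a l n) (Iio n) := fun _ _ hst =>
  congrArg (fun r : ℕ => (l * a + r) / (l + n)) (dependsOn_reds n hst)

lemma isElliptic_urnState (ha : a ∈ Icc (0 : ℝ) 1) (hl : 0 < l) (hf : ContinuousOn f (Icc 0 1))
    (hrange : ∀ p ∈ Icc (0 : ℝ) 1, f p ∈ Ioo (0 : ℝ) 1) :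
    IsElliptic fun n s => f (urnState a l n s) := by
  obtain ⟨p, hp, hmin⟩ := isCompact_Icc.exists_isMinOn (nonempty_Icc.2 zero_le_one)
    (hf.inf (continuousOn_const.sub hf))
  refine ⟨min (f p) (1 - f p), lt_min (hrange p hp).1 (sub_pos.2 (hrange p hp).2), fun n s => ?_⟩
  have hle : min (f p) (1 - f p) ≤ min (f (urnState a l n s)) (1 - f (urnState a l n s)) :=
    hmin (urnState_mem_Icc ha hl n s)
  exact ⟨(le_min_iff.1 hle).1, le_sub_comm.1 (le_min_iff.1 hle).2⟩

lemma measurable_draws_apply {Ω : Type*} [MeasurableSpace Ω] {β : ℕ → Ω → ℝ} (l : ℝ)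
    (h : Measurable (β k)) (h' : Measurable (β (k + 1))) :
    Measurable fun ω => draws l (fun n => β n ω) k := by
  refine measurable_to_bool ?_
  simp only [preimage, mem_singleton_iff, draws_eq_true_iff, redUpdate]
  exact measurableSet_eq_fun h' (((h.const_mul _).add_const 1).div_const _)

lemma measurable_draws {Ω : Type*} [MeasurableSpace Ω] {β : ℕ → Ω → ℝ} (l : ℝ)
    (h : ∀ n, Measurable (β n)) : Measurable fun ω => draws l fun n => β n ω :=
  measurable_pi_lambda _ fun k => measurable_draws_apply l (h k) (h (k + 1))

lemma measurableSet_draws_mem_cylinder {Ω : Type*} [MeasurableSpace Ω] {β : ℕ → Ω → ℝ} (l : ℝ)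
    (h : ∀ j ≤ n, Measurable (β j)) (b : ℕ → Bool) :
    MeasurableSet {ω | (draws l fun k => β k ω) ∈ PiNat.cylinder b n} := by
  simp only [PiNat.mem_cylinder_iff, ofPred_forall]
  exact MeasurableSet.iInter fun k => MeasurableSet.iInter fun hk =>
    measurableSet_eq_fun (measurable_draws_apply l (h k hk.le) (h (k + 1) hk)) measurable_const

lemma tendsto_add_floor_mul_div (a l : ℝ) (ht : 0 ≤ t) (c : ℕ) :
    Tendsto (fun N : ℕ => (l * a + (⌊t * N⌋₊ + c : ℕ)) / (l + (N + c : ℕ))) atTop (𝓝 t) := by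
  have hnat : Tendsto (fun N : ℕ => (N : ℝ)) atTop atTop := tendsto_natCast_atTop_atTop
  have hconst : ∀ x : ℝ, Tendsto (fun N : ℕ => x / (N : ℝ)) atTop (𝓝 0) := fun x =>
    tendsto_const_nhds.div_atTop hnat
  have hfloor : Tendsto (fun N : ℕ => (⌊t * N⌋₊ : ℝ) / N) atTop (𝓝 t) :=
    (tendsto_nat_floor_mul_div_atTop ht).comp hnat
  have hquot := (hfloor.add (hconst (l * a + c))).div ((hconst (l + c)).const_add 1) (by norm_num)
  simp only [add_zero, div_one] at hquot
  refine hquot.congr' ?_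
  filter_upwards [eventually_gt_atTop 0] with N hN
  have hN' : (N : ℝ) ≠ 0 := by positivity
  simp only [Pi.div_apply]
  rw [← add_div, one_add_div hN', div_div_div_cancel_right₀ hN']
  push_cast
  congr 1 <;> ring

lemma reds_decide_lt {r : ℕ} (h : r ≤ n) : reds (fun k => decide (k < r)) n = r := by
  suffices hmin : ∀ n, reds (fun k => decide (k < r)) n = min r n by rw [hmin, min_eq_left h]
  intro n
  induction n with
  | zero => simp
  | succ n ih =>
    simp only [reds_succ, ih, decide_eq_true_eq]
    split_ifs <;> omega

lemma exists_urnState_mem (ha : a ∈ Icc (0 : ℝ) 1) (hl : 0 < l) (ht : t ∈ Icc (0 : ℝ) 1)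
    {U : Set ℝ} (hU : U ∈ 𝓝[Icc 0 1] t) (y : ℕ) :
    ∃ b n, y < reds b n ∧ urnState a l n b ∈ U := by
  let b : ℕ → ℕ → Bool := fun N k => decide (k < ⌊t * N⌋₊ + (y + 1))
  have hreds : ∀ N, reds (b N) (N + (y + 1)) = ⌊t * N⌋₊ + (y + 1) := fun N =>
    reds_decide_lt (Nat.add_le_add_right
      (Nat.floor_le_of_le (mul_le_of_le_one_left N.cast_nonneg ht.2)) _)
  have hlim : Tendsto (fun N => urnState a l (N + (y + 1)) (b N)) atTop (𝓝[Icc 0 1] t) := by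
    refine tendsto_nhdsWithin_iff.2
      ⟨?_, Eventually.of_forall fun N => urnState_mem_Icc ha hl _ _⟩
    simp only [urnState, hreds]
    exact tendsto_add_floor_mul_div a l ht.1 (y + 1)
  obtain ⟨N, hN⟩ := (hlim.eventually hU).exists
  exact ⟨b N, N + (y + 1), by rw [hreds]; omega, hN⟩

lemma driftUpTo_lt_one {ν : Measure (ℕ → Bool)} [IsProbabilityMeasure ν]
    (h : IsDrawLaw ν fun n s => f (urnState a l n s))
    (hq : IsElliptic fun n s => f (urnState a l n s)) (ha : a ∈ Icc (0 : ℝ) 1) (hl : 0 < l)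
    (hf : ContinuousOn f (Icc 0 1))
    (htop : driftUpTo ν (fun n s => f (urnState a l n s)) ⊤ ≤ 1) (y : ℕ) :
    driftUpTo ν (fun n s => f (urnState a l n s)) y < 1 := by
  by_cases hhalf : ∀ t ∈ Icc (0 : ℝ) 1, f t ≤ 1 / 2
  · rw [driftUpTo_eq_zero fun n b => hhalf _ (urnState_mem_Icc ha hl n b)]
    exact zero_lt_one
  push Not at hhalf
  obtain ⟨t, ht, hft⟩ := hhalf
  obtain ⟨b, n, hy, hb⟩ := exists_urnState_mem ha hl ht ((hf t ht) (lt_mem_nhds hft)) y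
  have hhalf : 1 / 2 < f (urnState a l n b) := hb
  have hpos : ENNReal.ofReal (2 * f (urnState a l n b) - 1) * ν (PiNat.cylinder b n) ≠ 0 :=
    mul_ne_zero (ENNReal.ofReal_pos.2 (by linarith)).ne'
      (h.measure_cylinder_ne_zero hq b n)
  have hne : driftUpTo ν (fun n s => f (urnState a l n s)) y ≠ ⊤ :=
    ne_top_of_le_ne_top ENNReal.one_ne_top ((driftUpTo_mono _ _ le_top).trans htop)
  exact (ENNReal.lt_add_right hne hpos).trans_le ((h.driftUpTo_add_le hy).trans htop)

end Urn

lemma measurable_history {Ω : Type*} {α : ℕ → Ω → ℝ} {j n : ℕ} (hj : j ≤ n) :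
    Measurable[history α n] (α j) := by
  rw [measurable_iff_comap_le]
  exact le_iSup₂_of_le (f := fun j (_ : j ∈ Iic n) => MeasurableSpace.comap (α j) inferInstance)
    j hj le_rfl

namespace IsUrnProcess

variable {Ω : Type*} [MeasurableSpace Ω] {μ : Measure Ω} {f : ℝ → ℝ} {a l : ℝ} {α : ℕ → Ω → ℝ}

lemma history_le (h : IsUrnProcess μ f a l α) (n : ℕ) : history α n ≤ ‹MeasurableSpace Ω› :=
  iSup₂_le fun j _ => (h.measurable j).comap_le

lemma measurableSet_red (h : IsUrnProcess μ f a l α) (n : ℕ) :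
    MeasurableSet {ω | α (n + 1) ω = redUpdate (α n ω) (l + n)} :=
  measurableSet_eq_fun (h.measurable _) ((((h.measurable n).const_mul _).add_const 1).div_const _)

lemma measurableSet_blue (h : IsUrnProcess μ f a l α) (n : ℕ) :
    MeasurableSet {ω | α (n + 1) ω = blueUpdate (α n ω) (l + n)} :=
  measurableSet_eq_fun (h.measurable _) (((h.measurable n).const_mul _).div_const _)

variable [IsProbabilityMeasure μ]

lemma ae_red_or_blue (h : IsUrnProcess μ f a l α) (hl : 0 < l) (n : ℕ) :
    ∀ᵐ ω ∂μ, α (n + 1) ω = redUpdate (α n ω) (l + n) ∨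
      α (n + 1) ω = blueUpdate (α n ω) (l + n) := by
  let R : Set Ω := {ω | α (n + 1) ω = redUpdate (α n ω) (l + n)}
  let B : Set Ω := {ω | α (n + 1) ω = blueUpdate (α n ω) (l + n)}
  have hR : ∫ ω, f (α n ω) ∂μ = μ.real R := by
    simpa using setIntegral_eq_measureReal_inter_of_condExp (h.history_le n)
      MeasurableSet.univ (h.measurableSet_red n) (h.red n)
  have hB : ∫ ω, (1 - f (α n ω)) ∂μ = μ.real B := by
    simpa using setIntegral_eq_measureReal_inter_of_condExp (h.history_le n)
      MeasurableSet.univ (h.measurableSet_blue n) (h.blue n)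
  have hdisj : Disjoint R B := by
    refine Set.disjoint_left.2 fun ω hωR hωB => ?_
    have heq : redUpdate (α n ω) (l + n) = blueUpdate (α n ω) (l + n) := hωR.symm.trans hωB
    have hpos : l + (n : ℝ) + 1 ≠ 0 := by positivity
    rw [redUpdate, blueUpdate, div_left_inj' hpos] at heq
    linarith
  have hunion : μ.real (R ∪ B) = 1 := by
    rw [measureReal_union hdisj (h.measurableSet_blue n), ← hR, ← hB,
      integral_sub (integrable_const _) (integrable_condExp.congr (h.red n)), integral_const,
      probReal_univ, one_smul, add_sub_cancel]
  have hmeas : MeasurableSet (R ∪ B) := (h.measurableSet_red n).union (h.measurableSet_blue n)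
  exact (mem_ae_iff_prob_eq_one hmeas).2 (by rw [← ofReal_measureReal, hunion, ENNReal.ofReal_one])

lemma ae_eq_urnState (h : IsUrnProcess μ f a l α) (hl : 0 < l) :
    ∀ᵐ ω ∂μ, ∀ n, α n ω = urnState a l n (draws l fun k => α k ω) := by
  filter_upwards [h.init, ae_all_iff.2 (h.ae_red_or_blue hl)] with ω h₀ hω n
  induction n with
  | zero => rw [h₀, urnState_zero hl]
  | succ n ih =>
    rw [urnState_succ hl, ← ih]
    split_ifs with hd
    · exact draws_eq_true_iff.1 hd
    · exact (hω n).resolve_left fun hred => hd (draws_eq_true_iff.2 hred)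

lemma isDrawLaw (h : IsUrnProcess μ f a l α) (ha : a ∈ Icc (0 : ℝ) 1) (hl : 0 < l)
    (hrange : ∀ p ∈ Icc (0 : ℝ) 1, f p ∈ Icc (0 : ℝ) 1) :
    IsDrawLaw (μ.map fun ω => draws l fun k => α k ω) (fun n s => f (urnState a l n s)) where
  dependsOn n s t hst := congrArg f (dependsOn_urnState a l n hst)
  mem_Icc n s := hrange _ (urnState_mem_Icc ha hl n s)
  draw n b := by
    have hdraws := measurable_draws l h.measurable
    let A : Set Ω := {ω | (draws l fun k => α k ω) ∈ PiNat.cylinder b n}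
    have hA : MeasurableSet[history α n] A :=
      @measurableSet_draws_mem_cylinder n Ω (history α n) α l (fun j hj => measurable_history hj) b
    have hconst : ∫ ω in A, f (α n ω) ∂μ = μ.real A * f (urnState a l n b) := by
      rw [setIntegral_congr_ae (g := fun _ => f (urnState a l n b)) (h.history_le n A hA),
        setIntegral_const, smul_eq_mul]
      filter_upwards [h.ae_eq_urnState hl] with ω hω hωA
      rw [hω n, dependsOn_urnState a l n hωA]
    have hred := setIntegral_eq_measureReal_inter_of_condExp (h.history_le n) hA
      (h.measurableSet_red n) (h.red n)
    rw [Measure.map_apply hdraws ((measurableSet_cylinder b n).inter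
      (measurableSet_draw_eq n true)), Measure.map_apply hdraws (measurableSet_cylinder b n)]
    change μ (A ∩ {ω | draws l (fun k => α k ω) n = true}) = μ A * _
    simp only [draws_eq_true_iff]
    rw [← ofReal_measureReal, ← hred, hconst, ENNReal.ofReal_mul measureReal_nonneg,
      ofReal_measureReal]

lemma lintegral_totalDrift (h : IsUrnProcess μ f a l α) (hl : 0 < l)
    (hlaw : IsDrawLaw (μ.map fun ω => draws l fun k => α k ω) fun n s => f (urnState a l n s)) :
    ∫⁻ ω, totalDrift f (fun k => α k ω) ∂μ =
      driftUpTo (μ.map fun ω => draws l fun k => α k ω) (fun n s => f (urnState a l n s)) ⊤ := by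
  rw [driftUpTo, lintegral_map (hlaw.measurable_drift ⊤) (measurable_draws l h.measurable)]
  refine lintegral_congr_ae ?_
  filter_upwards [h.ae_eq_urnState hl] with ω hω
  simp only [sumUpTo_top, ← hω, totalDrift]

end IsUrnProcess

/-! ### Walks driven by independent draws -/

section Walk

variable {Ω : Type*} {s : ℤ → Ω → ℕ → Bool} {X : ℕ → Ω → ℤ}

/-- The draws at the sites `1, 2, …` to the right of the origin. -/
def rightDraws (s : ℤ → Ω → ℕ → Bool) (i : ℕ) (ω : Ω) : ℕ → Bool := s (1 + i) ω

/-- The draws at the sites `-1, -2, …` to the left of the origin, with the colours exchanged: they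
drive the reflected walk to the right of the origin. -/
def leftDraws (s : ℤ → Ω → ℕ → Bool) (i : ℕ) (ω : Ω) : ℕ → Bool := fun k => !s (-(1 + i)) ω k

lemma IsRecurrentPath.not_tendsto_atTop {X : ℕ → ℤ} (h : IsRecurrentPath X) :
    ¬ Tendsto X atTop atTop := fun hX =>
  have ⟨_, hn, hn'⟩ := ((h 0).and_eventually (hX.eventually_gt_atTop 0)).exists
  hn'.ne' hn

lemma isRecurrentPath_or_tendsto_atTop {ω : Ω} (hX : IsDriven (fun x => s x ω) fun n => X n ω)
    (hmixed : ∀ x, IsMixed (s x ω)) (hleft : backwardLim (fun i => leftDraws s i ω) = ⊤) :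
    (IsRecurrentPath (fun n => X n ω) ∧ backwardLim (fun i => rightDraws s i ω) = ⊤) ∨
      (Tendsto (fun n => X n ω) atTop atTop ∧ backwardLim (fun i => rightDraws s i ω) < ⊤) := by
  rcases hX.isRecurrentPath_or_isTransientPath hmixed with hrec | htop | hbot
  · exact Or.inl ⟨hrec, hX.backwardLim_eq_top (hmixed 1) hrec⟩
  · exact Or.inr ⟨htop, hX.backwardLim_lt_top htop⟩
  · exact absurd hleft (hX.neg.backwardLim_lt_top (tendsto_neg_atBot_atTop.comp hbot)).ne

variable [MeasurableSpace Ω] {μ : Measure Ω} {q : ℤ → ℕ → (ℕ → Bool) → ℝ}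

lemma iIndepFun_rightDraws (hi : iIndepFun s μ) : iIndepFun (rightDraws s) μ :=
  hi.precomp (g := fun i : ℕ => (1 : ℤ) + i) fun i j hij => by simpa using hij

lemma iIndepFun_leftDraws (hi : iIndepFun s μ) : iIndepFun (leftDraws s) μ :=
  (hi.precomp (g := fun i : ℕ => -((1 : ℤ) + i)) fun i j hij => by simpa using hij).comp
    (fun _ b k => !b k) fun _ => measurable_not_comp

variable [IsProbabilityMeasure μ]

lemma ae_backwardLim_leftDraws_eq_top (hs : ∀ x, Measurable (s x)) (hi : iIndepFun s μ)
    (hlaw : ∀ x, IsDrawLaw (μ.map (s x)) (q x)) (hq : ∀ x, IsElliptic (q x))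
    (hhalf : ∀ x n b, 1 / 2 ≤ q x n b) :
    ∀ᵐ ω ∂μ, backwardLim (fun i => leftDraws s i ω) = ⊤ := by
  have hmeas : ∀ i, Measurable (leftDraws s i) := fun i => measurable_not_comp.comp (hs _)
  have hprob : ∀ x, IsProbabilityMeasure (μ.map (s x)) := fun x =>
    Measure.isProbabilityMeasure_map (hs x).aemeasurable
  have hprob' : ∀ i, IsProbabilityMeasure (μ.map (leftDraws s i)) := fun i =>
    Measure.isProbabilityMeasure_map (hmeas i).aemeasurable
  have hflip : ∀ i : ℕ, IsDrawLaw (μ.map (leftDraws s i))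
      fun n b => 1 - q (-(1 + i)) n fun k => !b k := fun i => by
    have h := (hlaw (-(1 + i))).flip
    rwa [Measure.map_map measurable_not_comp (hs _)] at h
  exact ae_backwardLim_eq_top_of_le_half hmeas (iIndepFun_leftDraws hi) hflip
    (fun i => (hflip i).ae_isMixed (hq _).flip) fun i n b => by linarith [hhalf (-(1 + i)) n (!b ·)]

lemma ae_isRecurrentPath_or_ae_tendsto_atTop (hX : ∀ ω, IsDriven (fun x => s x ω) fun n => X n ω)
    (hs : ∀ x, Measurable (s x)) (hi : iIndepFun s μ)
    (hlaw : ∀ x, IsDrawLaw (μ.map (s x)) (q x)) (hq : ∀ x, IsElliptic (q x))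
    (hhalf : ∀ x n b, 1 / 2 ≤ q x n b) :
    ((∀ᵐ ω ∂μ, IsRecurrentPath fun n => X n ω) ∧
      ∀ᵐ ω ∂μ, backwardLim (fun i => rightDraws s i ω) = ⊤) ∨
    ((∀ᵐ ω ∂μ, Tendsto (fun n => X n ω) atTop atTop) ∧
      ∀ᵐ ω ∂μ, backwardLim (fun i => rightDraws s i ω) < ⊤) := by
  have hprob : ∀ x, IsProbabilityMeasure (μ.map (s x)) := fun x =>
    Measure.isProbabilityMeasure_map (hs x).aemeasurable
  have hmixed : ∀ x, ∀ᵐ ω ∂μ, IsMixed (s x ω) := fun x =>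
    ae_of_ae_map (hs x).aemeasurable ((hlaw x).ae_isMixed (hq x))
  have hpath := (ae_all_iff.2 hmixed).mp <|
    (ae_backwardLim_leftDraws_eq_top hs hi hlaw hq hhalf).mono fun ω hleft hω =>
      isRecurrentPath_or_tendsto_atTop (hX ω) hω hleft
  refine (ae_backwardLim_eq_top_or_ae_lt_top (fun i => hs (1 + i)) (iIndepFun_rightDraws hi)
    fun i => hmixed (1 + i)).imp (fun htop => ⟨?_, htop⟩) fun hlt => ⟨?_, hlt⟩
  · filter_upwards [hpath, htop] with ω hω htopω
    exact (hω.resolve_right fun h => h.2.ne htopω).1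
  · filter_upwards [hpath, hlt] with ω hω hltω
    exact (hω.resolve_left fun h => hltω.ne h.2).1

lemma ae_isRecurrentPath_iff_driftUpTo_top_le_one
    (hX : ∀ ω, IsDriven (fun x => s x ω) fun n => X n ω)
    (hs : ∀ x, Measurable (s x)) (hi : iIndepFun s μ)
    (hlaw : ∀ x, IsDrawLaw (μ.map (s x)) (q x)) (hq : ∀ x, IsElliptic (q x))
    (hhalf : ∀ x n b, 1 / 2 ≤ q x n b) (hright : ∀ i : ℕ, q (1 + i) = q 1)
    (hdrift : driftUpTo (μ.map (s 1)) (q 1) ⊤ ≤ 1 →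
      ∀ y : ℕ, driftUpTo (μ.map (s 1)) (q 1) y < 1) :
    (∀ᵐ ω ∂μ, IsRecurrentPath fun n => X n ω) ↔ driftUpTo (μ.map (s 1)) (q 1) ⊤ ≤ 1 := by
  have hprob : ∀ x, IsProbabilityMeasure (μ.map (s x)) := fun x =>
    Measure.isProbabilityMeasure_map (hs x).aemeasurable
  have hν : ∀ i, μ.map (rightDraws s i) = μ.map (s 1) := fun i =>
    (hright i ▸ hlaw (1 + i)).eq_of_isDrawLaw (hlaw 1)
  have hmixed := (hlaw 1).ae_isMixed (hq 1)
  have hmeas : ∀ i, Measurable (rightDraws s i) := fun i => hs (1 + i)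
  rcases ae_isRecurrentPath_or_ae_tendsto_atTop hX hs hi hlaw hq hhalf with
    ⟨hrec, htop⟩ | ⟨htrans, hlt⟩
  · exact iff_of_true hrec (driftUpTo_top_le_one hmeas (iIndepFun_rightDraws hi) hν (hlaw 1)
      hmixed (hhalf 1) htop)
  · refine iff_of_false (fun hrec => ?_) fun hle => ?_
    · obtain ⟨ω, hω, hω'⟩ := (hrec.and htrans).exists
      exact hω.not_tendsto_atTop hω'
    · exact not_ae_backwardLim_lt_top hmeas (iIndepFun_rightDraws hi) hν (hlaw 1) hmixed
        (hdrift hle) hlt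

end Walk

namespace IsReinforcedWalk

variable {Ω : Type*} [MeasurableSpace Ω] {μ : Measure Ω} {f : ℝ → ℝ} {a₀ l₀ : ℤ → ℝ}
  {α : ℤ → ℕ → Ω → ℝ} {X : ℕ → Ω → ℤ}

lemma isDriven (hX : IsReinforcedWalk μ f a₀ l₀ 0 α X) (ω : Ω) :
    IsDriven (fun x => draws (l₀ x) fun k => α x k ω) fun n => X n ω where
  start := hX.start ω
  step n := by
    rw [hX.step n ω (X n ω) _ rfl rfl]
    simp only [draws_eq_true_iff]

lemma iIndepFun_draws {x₀ : ℤ} (hX : IsReinforcedWalk μ f a₀ l₀ x₀ α X) :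
    iIndepFun (fun x ω => draws (l₀ x) fun k => α x k ω) μ :=
  hX.indep.comp (fun x => draws (l₀ x)) fun x =>
    measurable_draws (β := fun n (p : ℕ → ℝ) => p n) (l₀ x) measurable_pi_apply

end IsReinforcedWalk

theorem theorem1_general {Ω : Type*} [MeasurableSpace Ω] (μ : Measure Ω) [IsProbabilityMeasure μ]
    (f : ℝ → ℝ) (hf : ContinuousOn f (Icc 0 1))
    (hrange : ∀ p ∈ Icc (0 : ℝ) 1, f p ∈ Ico (1 / 2 : ℝ) 1)
    (a₀ l₀ : ℤ → ℝ) (ha₀ : ∀ x, a₀ x ∈ Icc (0 : ℝ) 1) (hl₀ : ∀ x, 0 < l₀ x)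
    (hw : ∀ x : ℤ, 1 ≤ x → a₀ x = a₀ 1 ∧ l₀ x = l₀ 1)
    (α : ℤ → ℕ → Ω → ℝ) (X : ℕ → Ω → ℤ) (hX : IsReinforcedWalk μ f a₀ l₀ 0 α X) :
    ((∀ᵐ ω ∂μ, IsRecurrentPath fun n => X n ω) ∨
      ∀ᵐ ω ∂μ, Tendsto (fun n => X n ω) atTop atTop) ∧
    ((∀ᵐ ω ∂μ, IsRecurrentPath fun n => X n ω) ↔
      ∫⁻ ω, totalDrift f (fun k => α 1 k ω) ∂μ ≤ 1) := by
  have hs : ∀ x, Measurable fun ω => draws (l₀ x) fun k => α x k ω := fun x =>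
    measurable_draws (l₀ x) (hX.urn x).measurable
  have hlaw := fun x => (hX.urn x).isDrawLaw (ha₀ x) (hl₀ x) fun p hp =>
    ⟨one_half_pos.le.trans (hrange p hp).1, (hrange p hp).2.le⟩
  have hq := fun x => isElliptic_urnState (ha₀ x) (hl₀ x) hf fun p hp =>
    ⟨one_half_pos.trans_le (hrange p hp).1, (hrange p hp).2⟩
  have hhalf := fun x n b => (hrange _ (urnState_mem_Icc (ha₀ x) (hl₀ x) n b)).1
  have hright : ∀ i : ℕ, (fun n b => f (urnState (a₀ (1 + i)) (l₀ (1 + i)) n b)) =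
      fun n b => f (urnState (a₀ 1) (l₀ 1) n b) := fun i => by
    rw [(hw (1 + i) (by omega)).1, (hw (1 + i) (by omega)).2]
  have hprob := Measure.isProbabilityMeasure_map (μ := μ) (hs 1).aemeasurable
  refine ⟨(ae_isRecurrentPath_or_ae_tendsto_atTop hX.isDriven hs hX.iIndepFun_draws hlaw hq
    hhalf).imp And.left And.left, ?_⟩
  rw [(hX.urn 1).lintegral_totalDrift (hl₀ 1) (hlaw 1)]
  exact ae_isRecurrentPath_iff_driftUpTo_top_le_one hX.isDriven hs hX.iIndepFun_draws hlaw hq hhalf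
    hright (driftUpTo_lt_one (hlaw 1) (hq 1) (ha₀ 1) (hl₀ 1) hf)

theorem theorem1 {Ω : Type*} [MeasurableSpace Ω] (μ : Measure Ω) [IsProbabilityMeasure μ]
    (f : ℝ → ℝ)
    (hf_range : ∀ p ∈ Set.Icc (0 : ℝ) 1, f p ∈ Set.Ioo (0 : ℝ) 1)
    (hf_smooth : ContDiffOn ℝ 3 f (Set.Icc 0 1))
    (hf_isolated : ∀ p ∈ Set.Icc (0 : ℝ) 1, f p = p →
      ∀ᶠ q in 𝓝[Set.Icc (0 : ℝ) 1 \ {p}] p, f q ≠ q)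
    (hf_half : ∀ p ∈ Set.Icc (0 : ℝ) 1, 1 / 2 ≤ f p)
    (a₀ l₀ : ℤ → ℝ)
    (ha₀ : ∀ x, a₀ x ∈ Set.Icc (0 : ℝ) 1) (hl₀ : ∀ x, 0 < l₀ x)
    (hw : ∀ x : ℤ, 1 ≤ x → a₀ x = a₀ 1 ∧ l₀ x = l₀ 1)
    (α : ℤ → ℕ → Ω → ℝ) (X : ℕ → Ω → ℤ)
    (hX : IsReinforcedWalk μ f a₀ l₀ 0 α X) :
    ((∀ᵐ ω ∂μ, IsRecurrentPath (fun n => X n ω)) ∨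
      (∀ᵐ ω ∂μ, IsTransientPath (fun n => X n ω))) ∧
    ((∀ᵐ ω ∂μ, IsRecurrentPath (fun n => X n ω)) ↔
      ∫⁻ ω, totalDrift f (fun k => α 1 k ω) ∂μ ≤ 1) := by
  obtain ⟨hdich, hiff⟩ := theorem1_general μ f hf_smooth.continuousOn
    (fun p hp => ⟨hf_half p hp, (hf_range p hp).2⟩) a₀ l₀ ha₀ hl₀ hw α X hX
  exact ⟨hdich.imp_right fun h => h.mono fun _ => Or.inl, hiff⟩
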